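/- **Models.** Logical variables (logvars) have finite nonempty domains of constants, and random-variable symbols have finite nonempty ranges. A parameterised random variable (PRV) $A=P(X^1,\dots,X^n)$ consists of a symbol, logvars and a time slice. A parfactor $\forall \mathbf X:\phi(A^1,\dots,A^n)\,|\,C$ has a nonnegative potential $\phi$, and its ground factors are its instances under the substitutions in the constraint $C$. A parameterised model (PM) is a finite collection of parfactors; $P_G=\frac1Z\prod_{f\in gr(G)}\phi(f)$ is its distribution over the ground random variables that occur in it. A parameterised probabilistic dynamic model (PDM) is a pair $(G_0,G_\to)$ of a PM for slice $0$ and a two-slice PM over slices $t-1,t$. Step $0$ contributes the parfactors of $G_0$ placed at time $0$; step $s\ge 1$ contributes the parfactors of $G_\to$ that contain a PRV of the current slice, placed at times $s-1,s$. The model unrolled to $t$ is the collection of the contributions of steps $0,\dots,t$, and $P(\,\cdot\mid\mathbf E_{0:t})$ refers to its distribution. The interface $\mathbf I_s$ consists of the PRVs of slice $s$ that share a parfactor of $G_\to$ with a PRV of slice $s+1$. **FO jtrees.** A parcluster is a set of PRVs with a constraint. An FO jtree for a PM $G$ is a tree of parclusters over PRVs of $G$ in which every parfactor of $G$ is assigned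 to exactly one parcluster that contains its PRVs (and their ground instances), and in which a ground random variable that belongs to two parclusters belongs to every parcluster on the path between them. Let $J_0$ be any FO jtree for $G_0$ together with a trivial parfactor $g^I_0\equiv1$ over $\mathbf I_0$; its in- and out-cluster is the parcluster that holds $g^I_0$. Let $J_s$ ($s\ge1$) be the instance at times $s-1,s$ of one FO jtree for the parfactors contributed by $G_\to$ together with trivial parfactors $g^I_{s-1}\equiv 1,\ g^I_s\equiv1$ over $\mathbf I_{s-1},\mathbf I_s$; its in-cluster holds $g^I_{s-1}$ and its out-cluster holds $g^I_s$. **Algorithm (LDJT).** Evidence $\mathbf E_s$ fixes the values of finitely many ground random variables of slice $s$ and is entered in the parclusters of $J_s$ that contain them. A message from a parcluster to a neighbour sums out all (ground instances of) PRVs outside the separator from the product of the content of the parcluster and the messages received from its other neighbours. Messages are passed inbound to, then outbound from, a root. * *Forward pass:* after message passing in $J_s$ (with $\alpha_{s-1}$ in its in-cluster if $s\ge1$), $\alpha_s$ is obtained by summing out all PRVs not in $\mathbf I_s$ from the content of the out-cluster and its received messages. * *Backward pass at current time $t$:* for $s=t,t-1,\dots,1$, the message $\beta_s$ is obtained by removing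 $\alpha_{s-1}$ from the content of the in-cluster of $J_s$ and summing out all PRVs not in $\mathbf I_{s-1}$ from the remaining content and the received messages; $\beta_s$ is then added to the out-cluster of $J_{s-1}$, in which messages are passed. For each step $s<t$ the tree $J_s$ is either *preserved* from the forward pass, with its messages, and only an outbound pass from the out-cluster is made, or *reinstantiated* from $\mathbf E_s,\alpha_{s-1},\beta_{s+1}$ with a complete message pass; for steps without queries, reinstantiation may use only an inbound pass to the in-cluster. * *Query:* $P(v=a)$ is answered from a parcluster of $J_\pi$ that contains $v$, by summing out all other random variables from its content and received messages and normalising. **Theorem (LDJT is correct regarding smoothing).** Let $t\ge 0$, and let $\mathbf E_{0:t}$ be evidence on ground random variables of the model unrolled to $t$. For every choice of the FO jtrees, of the roots, and of the way in which each tree is instantiated in the backward pass: 1. For all $1\le s\le t$, $\beta_s$ is exact: as a function of the values of $\mathbf I_{s-1}$ it equals the sum, over all joint values of the ground random variables of $J_s,\dots,J_t$ outside $\mathbf I_{s-1}$, of the product of all ground factors contributed by steps $s,\dots,t$ and of the indicator that $\mathbf E_s,\dots,\mathbf E_t$ hold. 2. For every $\pi<t$ for which $J_\pi$ is not instantiated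 with an inbound pass only, and every ground random variable $v=A_\pi$ of slice $\pi$ of the model unrolled to $t$, some parcluster of $J_\pi$ contains $v$. If moreover $P(\mathbf E_{0:t})>0$, then for every such parcluster and every value $a$, the answer computed by LDJT from $J_\pi$ once the backward pass has reached $\pi$ equals $P(A_\pi=a\mid \mathbf E_{0:t})$. -/

import Mathlib

open scoped NNReal

noncomputable section

universe u v w z

set_option linter.checkUnivs false

namespace LiftedDynamic

/-- Logical variables with finite nonempty domains of constants, and symbols of random variables
with finite nonempty ranges. -/
structure Vocabulary where
  LogVar : Type u
  Const : Type v
  RandVar : Type w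
  dom : LogVar → Finset Const
  dom_nonempty : ∀ X, (dom X).Nonempty
  range : RandVar → Type z
  rangeFintype : ∀ P, Fintype (range P)
  rangeNonempty : ∀ P, Nonempty (range P)

attribute [instance] Vocabulary.rangeFintype Vocabulary.rangeNonempty

/-- A parameterised random variable (PRV) `P(X¹,…,Xⁿ)`, located in a time slice.  The type `τ` of
slices is `Unit` for a one-slice model, `TwoSlice` for a two-slice model, and `ℕ` for actual time. -/
structure PRV (V : Vocabulary) (τ : Type) where
  symbol : V.RandVar
  args : List V.LogVar
  time : τ

/-- A ground random variable `P(c¹,…,cⁿ)` in a time slice. -/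
structure GroundRV (V : Vocabulary) (τ : Type) where
  symbol : V.RandVar
  consts : List V.Const
  time : τ

instance (V : Vocabulary) (τ : Type) : DecidableEq (PRV V τ) := Classical.decEq _

instance (V : Vocabulary) (τ : Type) : DecidableEq (GroundRV V τ) := Classical.decEq _

/-- Values for all ground random variables. -/
abbrev Assignment (V : Vocabulary) (τ : Type) := ∀ v : GroundRV V τ, V.range v.symbol

/-- An arbitrary assignment, used where the value of an expression does not depend on it. -/
def someAssignment (V : Vocabulary) (τ : Type) : Assignment V τ :=
  fun v => Classical.arbitrary (V.range v.symbol)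

/-- Nonnegative functions of an assignment. -/
abbrev Factor (V : Vocabulary) (τ : Type) := Assignment V τ → ℝ≥0

/-- `∑_S f`: sum over all joint values of the random variables in `S`; the result is a function of
the remaining ones. -/
def sumOut {V : Vocabulary} {τ : Type} (S : Finset (GroundRV V τ)) (f : Factor V τ) : Factor V τ :=
  fun x => ∑ y : (∀ v : S, V.range v.1.symbol), f (Function.updateFinset x S y)

section Models

variable {V : Vocabulary} {τ σ : Type}

/-- Move a PRV to another slice. -/
def PRV.map (f : τ → σ) (A : PRV V τ) : PRV V σ := ⟨A.symbol, A.args, f A.time⟩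

/-- The instance of a PRV under a substitution of the logical variables in `X`. -/
def PRV.ground (A : PRV V τ) (X : Finset V.LogVar) (h : ∀ x ∈ A.args, x ∈ X) (θ : X → V.Const) :
    GroundRV V τ :=
  ⟨A.symbol, A.args.pmap (fun x hx => θ ⟨x, hx⟩) h, A.time⟩

/-- A parfactor `∀ X : φ(A¹,…,Aⁿ) | C`. -/
structure Parfactor (V : Vocabulary) (τ : Type) where
  logvars : Finset V.LogVar
  constr : Finset (logvars → V.Const)
  constr_dom : ∀ θ ∈ constr, ∀ x : logvars, θ x ∈ V.dom x.1
  arity : ℕ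
  args : Fin arity → PRV V τ
  args_logvars : ∀ i, ∀ x ∈ (args i).args, x ∈ logvars
  φ : (∀ i, V.range (args i).symbol) → ℝ≥0

/-- The `i`-th argument of the ground factor that belongs to a substitution. -/
def Parfactor.groundArg (g : Parfactor V τ) (θ : g.logvars → V.Const) (i : Fin g.arity) :
    GroundRV V τ :=
  (g.args i).ground g.logvars (g.args_logvars i) θ

/-- The ground random variables that occur in the ground factors of a parfactor. -/
def Parfactor.groundRVs (g : Parfactor V τ) : Finset (GroundRV V τ) :=
  g.constr.biUnion fun θ => Finset.univ.image (g.groundArg θ)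

/-- The product of all ground factors of a parfactor. -/
def Parfactor.weight (g : Parfactor V τ) : Factor V τ :=
  fun x => ∏ θ ∈ g.constr, g.φ fun i => x (g.groundArg θ i)

/-- Move a parfactor to other slices. -/
def Parfactor.map (f : τ → σ) (g : Parfactor V τ) : Parfactor V σ where
  logvars := g.logvars
  constr := g.constr
  constr_dom := g.constr_dom
  arity := g.arity
  args := fun i => (g.args i).map f
  args_logvars := g.args_logvars
  φ := g.φ

/-- A parameterised probabilistic model (PM): a finite collection of parfactors. -/
abbrev PM (V : Vocabulary) (τ : Type) := Multiset (Parfactor V τ)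

namespace PM

def groundRVs (G : PM V τ) : Finset (GroundRV V τ) := (Multiset.map Parfactor.groundRVs G).sup

/-- The product of all ground factors of a model. -/
def weight (G : PM V τ) : Factor V τ := fun x => (Multiset.map (fun g => g.weight x) G).prod

/-- The normalisation constant `Z`. -/
def partition (G : PM V τ) : ℝ≥0 := sumOut G.groundRVs G.weight (someAssignment V τ)

/-- The full joint distribution `P_G`. -/
def joint (G : PM V τ) : Factor V τ := fun x => G.weight x / G.partition

/-- The probability under `P_G` of an event about the random variables of `G`. -/
def prob (G : PM V τ) (S : Set (Assignment V τ)) : ℝ≥0 :=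
  sumOut G.groundRVs (fun x => S.indicator G.joint x) (someAssignment V τ)

/-- `P_G(v = a | S)`. -/
def query (G : PM V τ) (v : GroundRV V τ) (a : V.range v.symbol) (S : Set (Assignment V τ)) :
    ℝ≥0 :=
  G.prob ({x | x v = a} ∩ S) / G.prob S

end PM

end Models

/-! ### Parameterised probabilistic dynamic models -/

/-- The slices `t - 1` and `t` of a two-slice model. -/
inductive TwoSlice : Type where
  | prev : TwoSlice
  | cur : TwoSlice

instance : DecidableEq TwoSlice := Classical.decEq _

/-- The actual times of the two slices when the current one is `s + 1`. -/
def TwoSlice.toTime (s : ℕ) : TwoSlice → ℕ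
  | .prev => s
  | .cur => s + 1

/-- A parameterised probabilistic dynamic model `(G₀, G_→)`. -/
structure PDM (V : Vocabulary) where
  initial : PM V Unit
  transition : PM V TwoSlice

namespace PDM

variable {V : Vocabulary} (D : PDM V)

/-- The parfactors of `G_→` that concern the current slice.  Those over slice `t - 1` alone repeat
parfactors that the model already has for that slice. -/
def step : PM V TwoSlice := D.transition.filter fun g => ∃ j, (g.args j).time = TwoSlice.cur

/-- The parfactors that slice `s` contributes to the unrolled model. -/
def modelAt : ℕ → PM V ℕ
  | 0 => D.initial.map (Parfactor.map fun _ => 0)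
  | s + 1 => D.step.map (Parfactor.map (TwoSlice.toTime s))

/-- The model `G` unrolled for the time steps `0,…,t`. -/
def unrolled (t : ℕ) : PM V ℕ := ∑ s ∈ Finset.range (t + 1), D.modelAt s

/-- The forward interface: the PRVs that share a parfactor with a PRV of the next slice. -/
def interface : Finset (PRV V Unit) :=
  (D.step.bind fun g =>
    ((Finset.univ.val.map g.args).filter fun A => A.time = TwoSlice.prev).map
      (PRV.map fun _ => ())).toFinset

theorem mem_interface (A : PRV V Unit) :
    A ∈ D.interface ↔ ∃ g ∈ D.transition,
      (∃ i, g.args i = A.map fun _ => TwoSlice.prev) ∧ ∃ j, (g.args j).time = TwoSlice.cur := by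
  simp only [interface, step, Multiset.mem_toFinset, Multiset.mem_bind, Multiset.mem_filter,
    Multiset.mem_map]
  constructor
  · rintro ⟨g, ⟨hg, hc⟩, B, ⟨⟨i, -, rfl⟩, hB⟩, rfl⟩
    refine ⟨g, hg, ⟨i, ?_⟩, hc⟩
    simp [PRV.map, ← hB]
  · rintro ⟨g, hg, ⟨i, hi⟩, hc⟩
    exact ⟨g, ⟨hg, hc⟩, g.args i, ⟨⟨i, Finset.mem_univ_val i, rfl⟩, by rw [hi]; rfl⟩,
      by rw [hi]; rfl⟩

open Classical in
/-- The parfactor `g^I` over the interface in slice `c`, without influence on the distribution. -/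
def interfaceParfactor {τ : Type} (c : τ) : Parfactor V τ where
  logvars := D.interface.biUnion fun A => A.args.toFinset
  constr := Fintype.piFinset fun x => V.dom x.1
  constr_dom := fun _ hθ x => Fintype.mem_piFinset.mp hθ x
  arity := D.interface.card
  args := fun i => (D.interface.equivFin.symm i).1.map fun _ => c
  args_logvars := fun i _ hx => Finset.mem_biUnion.mpr
    ⟨_, (D.interface.equivFin.symm i).2, List.mem_toFinset.mpr hx⟩
  φ := fun _ => 1

/-- The ground random variables of the interface `I_s`. -/
def interfaceRVs (s : ℕ) : Finset (GroundRV V ℕ) := (D.interfaceParfactor s).groundRVs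

end PDM

/-! ### First-order junction trees -/

section Trees

variable {V : Vocabulary} {τ σ : Type}

/-- A parcluster `∀ L : A | C`. -/
structure Parcluster (V : Vocabulary) (τ : Type) where
  logvars : Finset V.LogVar
  constr : Finset (logvars → V.Const)
  constr_dom : ∀ θ ∈ constr, ∀ x : logvars, θ x ∈ V.dom x.1
  prvs : Finset (PRV V τ)
  prvs_logvars : ∀ A ∈ prvs, ∀ x ∈ A.args, x ∈ logvars

def Parcluster.groundRVs (C : Parcluster V τ) : Finset (GroundRV V τ) :=
  C.constr.biUnion fun θ => C.prvs.attach.image fun A =>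
    A.1.ground C.logvars (C.prvs_logvars A.1 A.2) θ

def Parcluster.map (f : τ → σ) (C : Parcluster V τ) : Parcluster V σ where
  logvars := C.logvars
  constr := C.constr
  constr_dom := C.constr_dom
  prvs := C.prvs.image (PRV.map f)
  prvs_logvars := by
    intro A hA
    obtain ⟨B, hB, rfl⟩ := Finset.mem_image.mp hA
    exact C.prvs_logvars B hB

/-- The condition under which a parfactor may be assigned to a parcluster: its PRVs belong to the
parcluster, and its constraint is contained in that of the parcluster. -/
def Parfactor.Fits (g : Parfactor V τ) (C : Parcluster V τ) : Prop :=
  (∀ i, g.args i ∈ C.prvs) ∧ g.groundRVs ⊆ C.groundRVs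

/-- A graph of parclusters with local models and a labelled in-cluster and out-cluster. -/
structure ParclusterGraph (V : Vocabulary) (τ : Type) where
  size : ℕ
  graph : SimpleGraph (Fin size)
  cluster : Fin size → Parcluster V τ
  localModel : Fin size → PM V τ
  inCluster : Fin size
  outCluster : Fin size

/-- `J` is an FO jtree for the model `G`. -/
structure ParclusterGraph.IsFOJTree (J : ParclusterGraph V τ) (G : PM V τ) : Prop where
  isTree : J.graph.IsTree
  prvs_from : ∀ i, ∀ A ∈ (J.cluster i).prvs, ∃ g ∈ G, ∃ k, g.args k = A
  assigned : ∑ i, J.localModel i = G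
  fits : ∀ i, ∀ g ∈ J.localModel i, g.Fits (J.cluster i)
  runningIntersection : ∀ (i j k : Fin J.size) (p : J.graph.Walk i j), p.IsPath → k ∈ p.support →
    ∀ v ∈ (J.cluster i).groundRVs, v ∈ (J.cluster j).groundRVs → v ∈ (J.cluster k).groundRVs

/-- Instantiate the structure for actual slices. -/
def ParclusterGraph.map (f : τ → σ) (J : ParclusterGraph V τ) : ParclusterGraph V σ where
  size := J.size
  graph := J.graph
  cluster := fun i => (J.cluster i).map f
  localModel := fun i => (J.localModel i).map (Parfactor.map f)
  inCluster := J.inCluster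
  outCluster := J.outCluster

/-- The ground random variables of a parcluster graph. -/
def ParclusterGraph.groundRVs (J : ParclusterGraph V τ) : Finset (GroundRV V τ) :=
  Finset.univ.biUnion fun i => (J.cluster i).groundRVs

/-- `J₀` is an FO jtree for `G₀` with the interface parfactor `g^I_0`, and the parcluster with
`g^I_0` is the in- and out-cluster. -/
def PDM.IsInitialTree (D : PDM V) (J : ParclusterGraph V Unit) : Prop :=
  J.IsFOJTree (D.initial + {D.interfaceParfactor ()}) ∧
    D.interfaceParfactor () ∈ J.localModel J.outCluster ∧ J.inCluster = J.outCluster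

/-- `J` is an FO jtree for `G_→` without the non-interface PRVs of slice `t - 1` and with the
interface parfactors `g^I_{t-1}` and `g^I_t`, whose parclusters are the in- and out-cluster. -/
def PDM.IsStepTree (D : PDM V) (J : ParclusterGraph V TwoSlice) : Prop :=
  J.IsFOJTree (D.step + {D.interfaceParfactor TwoSlice.prev} +
      {D.interfaceParfactor TwoSlice.cur}) ∧
    D.interfaceParfactor TwoSlice.prev ∈ J.localModel J.inCluster ∧
    D.interfaceParfactor TwoSlice.cur ∈ J.localModel J.outCluster

/-- The FO jtree `J_s` instantiated for time step `s`. -/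
def treeAt (J₀ : ParclusterGraph V Unit) (J₁ : ParclusterGraph V TwoSlice) :
    ℕ → ParclusterGraph V ℕ
  | 0 => J₀.map fun _ => 0
  | s + 1 => J₁.map (TwoSlice.toTime s)

/-- `messages i j` is the message that parcluster `i` has sent to parcluster `j`. -/
abbrev ParclusterGraph.Messages (J : ParclusterGraph V τ) := Fin J.size → Fin J.size → Factor V τ

namespace ParclusterGraph

variable (J : ParclusterGraph V τ)

open Classical in
/-- The message from `i` to `j`: eliminate all non-separator PRVs from the content of `i` and the
messages that `i` received from its other neighbours. -/
def message (content : Fin J.size → Factor V τ) (m : J.Messages) (i j : Fin J.size) :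
    Factor V τ :=
  sumOut ((J.cluster i).groundRVs \ (J.cluster j).groundRVs)
    (content i * ∏ k with J.graph.Adj k i ∧ k ≠ j, m k i)

open Classical in
/-- Messages sent from distance `d + 1` to distance `d` of the root, the farthest ones first. -/
def inboundPass (content : Fin J.size → Factor V τ) (root : Fin J.size) (m : J.Messages) :
    J.Messages :=
  (List.range J.size).reverse.foldl (fun m d => fun i j =>
    if J.graph.Adj i j ∧ J.graph.dist root i = d + 1 ∧ J.graph.dist root j = d then
      J.message content m i j else m i j) m

open Classical in
/-- Messages sent from distance `d` to distance `d + 1` of the root, the nearest ones first. -/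
def outboundPass (content : Fin J.size → Factor V τ) (root : Fin J.size) (m : J.Messages) :
    J.Messages :=
  (List.range J.size).foldl (fun m d => fun i j =>
    if J.graph.Adj i j ∧ J.graph.dist root i = d ∧ J.graph.dist root j = d + 1 then
      J.message content m i j else m i j) m

/-- A complete message pass; `1` stands for a message that was not sent yet. -/
def passMessages (content : Fin J.size → Factor V τ) (root : Fin J.size) : J.Messages :=
  J.outboundPass content root (J.inboundPass content root 1)

open Classical in
/-- The content of parcluster `i` combined with all messages that it received. -/
def belief (content : Fin J.size → Factor V τ) (m : J.Messages) (i : Fin J.size) : Factor V τ :=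
  content i * ∏ k with J.graph.Adj k i, m k i

/-- The answer to a query for `v = a` from parcluster `k`: sum out all non-query terms and
normalise. -/
def answer (content : Fin J.size → Factor V τ) (m : J.Messages) (k : Fin J.size)
    (v : GroundRV V τ) (a : V.range v.symbol) : ℝ≥0 :=
  let marginal : V.range v.symbol → ℝ≥0 := fun b =>
    sumOut ((J.cluster k).groundRVs \ {v}) (J.belief content m k)
      (Function.update (someAssignment V τ) v b)
  marginal a / ∑ b, marginal b

end ParclusterGraph

end Trees

/-! ### The lifted dynamic junction tree algorithm -/

/-- Evidence: `obs s` is the set of ground random variables observed in time step `s`, with values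
given by `val`. -/
structure Evidence (V : Vocabulary) where
  obs : ℕ → Finset (GroundRV V ℕ)
  val : Assignment V ℕ

/-- The event `E_{0:t}`. -/
def Evidence.upTo {V : Vocabulary} (E : Evidence V) (t : ℕ) : Set (Assignment V ℕ) :=
  {x | ∀ s ≤ t, ∀ v ∈ E.obs s, x v = E.val v}

open Classical in
/-- The factor that is `1` on assignments that agree with the values `e` on `O`, else `0`. -/
def agree {V : Vocabulary} (O : Finset (GroundRV V ℕ)) (e : Assignment V ℕ) : Factor V ℕ :=
  fun x => if ∀ v ∈ O, x v = e v then 1 else 0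

/-- How the FO jtree of an earlier time step is obtained during a backward pass: `preserve` keeps
the FO jtree of the forward pass with its messages, and distributes the new message from the
out-cluster; `reinstantiate` builds it again from evidence, `α` and `β` and performs a complete
message pass; `reinstantiateInbound` does the latter with only the inbound pass towards the
in-cluster, which serves time steps without queries. -/
inductive Instantiation : Type where
  | preserve : Instantiation
  | reinstantiate : Instantiation
  | reinstantiateInbound : Instantiation

/-- The free choices of the algorithm for a model: the two FO jtree structures, the roots of the
message passes, and the way in which FO jtrees are instantiated during a backward pass. -/
structure LDJT {V : Vocabulary} (D : PDM V) where
  J₀ : ParclusterGraph V Unit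
  J₁ : ParclusterGraph V TwoSlice
  initialTree : D.IsInitialTree J₀
  stepTree : D.IsStepTree J₁
  forwardRoot : ∀ s, Fin (treeAt J₀ J₁ s).size
  backwardRoot : ∀ s, Fin (treeAt J₀ J₁ s).size
  mode : ℕ → Instantiation

namespace LDJT

variable {V : Vocabulary} {D : PDM V} (A : LDJT D) (E : Evidence V)

/-- The FO jtree for time step `s`. -/
def tree (s : ℕ) : ParclusterGraph V ℕ := treeAt A.J₀ A.J₁ s

/-- The content of parcluster `i` in time step `s`: the local model, the evidence about its random
variables, the message `α` (if any) in the in-cluster, the message `β` (if any) in the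
out-cluster. -/
def content (s : ℕ) (α β : Option (Factor V ℕ)) (i : Fin (A.tree s).size) : Factor V ℕ :=
  PM.weight ((A.tree s).localModel i) *
    agree (E.obs s ∩ ((A.tree s).cluster i).groundRVs) E.val *
    (if i = (A.tree s).inCluster then α.getD 1 else 1) *
    (if i = (A.tree s).outCluster then β.getD 1 else 1)

/-- The messages in `J_s` after the forward pass reached `s`, with incoming message `α`. -/
def forwardMessages (s : ℕ) (α : Option (Factor V ℕ)) : (A.tree s).Messages :=
  (A.tree s).passMessages (A.content E s α none) (A.forwardRoot s)

/-- The message out of the out-cluster of `J_s` over the interface `I_s`. -/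
def forwardStep (s : ℕ) (α : Option (Factor V ℕ)) : Factor V ℕ :=
  sumOut (((A.tree s).cluster (A.tree s).outCluster).groundRVs \ D.interfaceRVs s)
    ((A.tree s).belief (A.content E s α none) (A.forwardMessages E s α) (A.tree s).outCluster)

/-- The message `α_s`. -/
def alpha : ℕ → Factor V ℕ
  | 0 => A.forwardStep E 0 none
  | s + 1 => A.forwardStep E (s + 1) (some (alpha s))

/-- The message that `J_s` receives in the forward pass, `α_{s-1}`; there is none for `s = 0`. -/
def alphaIn : ℕ → Option (Factor V ℕ)
  | 0 => none
  | s + 1 => some (A.alpha E s)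

/-- The messages in `J_s`, given the incoming message `β`; without such a message, `s` is the
current time step, and the messages are those of the forward pass. -/
def messages (s : ℕ) : Option (Factor V ℕ) → (A.tree s).Messages
  | none => A.forwardMessages E s (A.alphaIn E s)
  | some β =>
    match A.mode s with
    | .preserve =>
      (A.tree s).outboundPass (A.content E s (A.alphaIn E s) (some β)) (A.tree s).outCluster
        (A.forwardMessages E s (A.alphaIn E s))
    | .reinstantiate =>
      (A.tree s).passMessages (A.content E s (A.alphaIn E s) (some β)) (A.backwardRoot s)
    | .reinstantiateInbound =>
      (A.tree s).inboundPass (A.content E s (A.alphaIn E s) (some β)) (A.tree s).inCluster 1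

/-- The message out of the in-cluster of `J_s` over the interface `I_{s-1}`: `α_{s-1}` is removed
from the content of the in-cluster, the messages received from the neighbours are kept. -/
def backwardStep (s : ℕ) (β : Option (Factor V ℕ)) : Factor V ℕ :=
  sumOut (((A.tree s).cluster (A.tree s).inCluster).groundRVs \ D.interfaceRVs (s - 1))
    ((A.tree s).belief (A.content E s none β) (A.messages E s β) (A.tree s).inCluster)

/-- The message `β_s` when the current time step is `t`, for `1 ≤ s ≤ t`. -/
def beta (t s : ℕ) : Factor V ℕ :=
  A.backwardStep E s (if s < t then some (beta t (s + 1)) else none)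
termination_by t - s

/-- The message that `J_s` receives in the backward pass from `t`, `β_{s+1}`; none for `s = t`. -/
def betaIn (t s : ℕ) : Option (Factor V ℕ) := if s < t then some (A.beta E t (s + 1)) else none

/-- The answer that the algorithm, at time step `t` and with evidence up to `t`, gives for `v = a`
from parcluster `k` of `J_s`, for `s ≤ t`. -/
def answer (t s : ℕ) (k : Fin (A.tree s).size) (v : GroundRV V ℕ) (a : V.range v.symbol) : ℝ≥0 :=
  (A.tree s).answer (A.content E s (A.alphaIn E s) (A.betaIn E t s))
    (A.messages E s (A.betaIn E t s)) k v a

/-- The correct value of `β_s`: the sum, over all joint values of the random variables of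
`J_s,…,J_t` outside the interface `I_{s-1}`, of all ground factors that the time steps `s,…,t`
contribute to the unrolled model, together with the evidence of these time steps. -/
def exactBeta (t s : ℕ) : Factor V ℕ :=
  sumOut (((Finset.Icc s t).biUnion fun r => (A.tree r).groundRVs) \ D.interfaceRVs (s - 1))
    (∏ r ∈ Finset.Icc s t, PM.weight (D.modelAt r) * agree (E.obs r) E.val)

end LDJT

end LiftedDynamic

end

/-!
The argument splits into a statement about a single junction tree and one about the chain of trees.

*One tree.*  Both sides of an edge `i j` share only random variables of the separator.  The message
from `i` to `j` should be the product of all contents on the side of `i`, with everything outside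
`j` summed out (`ParclusterGraph.exactMessage`).  By distributivity, in the form `prod_sumOut`, a
message that is computed from correct messages is correct (`IsJunctionTree.message_eq`); an inbound
pass therefore makes the messages towards the root correct, and an outbound pass all the others.
A correct message towards `i` does not involve the content of `i`.  This is why `α` may be removed
from the in-cluster after message passing, why an inbound pass to the in-cluster suffices for `β`,
and why a preserved tree needs an outbound pass from the out-cluster alone
(`IsJunctionTree.belief_eq`, `IsJunctionTree.outboundPass_eq_of_change`).

*The chain.*  The trees of two time steps share random variables only if the steps are consecutive,
and then only those of the interface, which lie in the out-cluster of the one and in the in-cluster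
of the other (`LDJT.mem_interfaceRVs_of_mem_tree`).  Hence what lies before and what lies after a
step can be summed out separately (`sumOut_mul_sumOut_mul_sumOut`), and induction along the chain
shows that `α` and `β` are the exact sums over the past and over the future (`LDJT.alphaIn_eq`,
`LDJT.beta_eq_exactBeta`).  A query thus computes a marginal of the whole unrolled model up to a
nonzero constant, which the normalisation removes (`LDJT.answer_eq_query`).
-/

namespace LiftedDynamic

/-! ### Summing out random variables -/

section SumOut

variable {V : Vocabulary} {τ : Type}

theorem sumOut_empty (f : Factor V τ) : sumOut ∅ f = f := by
  funext x
  simp [sumOut]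

theorem sumOut_union {S T : Finset (GroundRV V τ)} (h : Disjoint S T) (f : Factor V τ) :
    sumOut S (sumOut T f) = sumOut (S ∪ T) f := by
  funext x
  simp only [sumOut, Function.updateFinset_updateFinset h]
  rw [← Fintype.sum_prod_type'
    (f := fun y z => f (Function.updateFinset x (S ∪ T)
      (Equiv.piFinsetUnion (fun v : GroundRV V τ => V.range v.symbol) h (y, z))))]
  exact Fintype.sum_equiv
    (Equiv.piFinsetUnion (fun v : GroundRV V τ => V.range v.symbol) h) _ _ fun _ => rfl

theorem sumOut_apply_congr {S : Finset (GroundRV V τ)} {f g : Factor V τ}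
    {x : Assignment V τ} (h : ∀ y, (∀ v ∉ S, y v = x v) → f y = g y) :
    sumOut S f x = sumOut S g x :=
  Finset.sum_congr rfl fun y _ => h _ fun v hv => by simp [Function.updateFinset, hv]

/-- A factor that does not mention the summed random variables can be pulled out of a sum. -/
theorem sumOut_mul_left {S : Finset (GroundRV V τ)} {U : Set (GroundRV V τ)} {f : Factor V τ}
    (hf : DependsOn f U) (h : ∀ v ∈ U, v ∉ S) (g : Factor V τ) :
    sumOut S (f * g) = f * sumOut S g := by
  funext x
  simp only [sumOut, Pi.mul_apply, Finset.mul_sum]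
  refine Finset.sum_congr rfl fun y _ => ?_
  congr 1
  exact hf fun v hv => by simp [Function.updateFinset, h v hv]

theorem sumOut_mul_right {S : Finset (GroundRV V τ)} {U : Set (GroundRV V τ)} {g : Factor V τ}
    (hg : DependsOn g U) (h : ∀ v ∈ U, v ∉ S) (f : Factor V τ) :
    sumOut S (f * g) = sumOut S f * g := by
  rw [mul_comm, sumOut_mul_left hg h, mul_comm]

theorem dependsOn_mul {f g : Factor V τ} {U : Set (GroundRV V τ)} (hf : DependsOn f U)
    (hg : DependsOn g U) : DependsOn (f * g) U := fun x y h => by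
  simp only [Pi.mul_apply, hf h, hg h]

theorem dependsOn_one (U : Set (GroundRV V τ)) : DependsOn (1 : Factor V τ) U :=
  fun _ _ _ => rfl

theorem dependsOn_prod {ι : Type*} {K : Finset ι} {f : ι → Factor V τ} {U : Set (GroundRV V τ)}
    (h : ∀ k ∈ K, DependsOn (f k) U) : DependsOn (∏ k ∈ K, f k) U := fun x y hxy => by
  simp only [Finset.prod_apply]
  exact Finset.prod_congr rfl fun k hk => h k hk hxy

theorem dependsOn_sumOut {S : Finset (GroundRV V τ)} {f : Factor V τ} {U : Set (GroundRV V τ)}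
    (hf : DependsOn f U) : DependsOn (sumOut S f) (U \ S) := fun x y h => by
  refine Finset.sum_congr rfl fun z _ => hf fun v hv => ?_
  by_cases hS : v ∈ S
  · simp [Function.updateFinset, hS]
  · simpa [Function.updateFinset, hS] using h v ⟨hv, hS⟩

theorem dependsOn_sumOut_sdiff {R T : Finset (GroundRV V τ)} {f : Factor V τ}
    (hf : DependsOn f R) : DependsOn (sumOut (R \ T) f) T :=
  (dependsOn_sumOut hf).mono fun v hv => by
    simp only [Set.mem_sdiff, Finset.mem_coe, Finset.mem_sdiff] at hv
    by_contra h
    exact hv.2 ⟨hv.1, h⟩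

theorem sumOut_sdiff_sumOut_sdiff {T S R : Finset (GroundRV V τ)} (hTS : T ⊆ S) (hSR : S ⊆ R)
    (f : Factor V τ) : sumOut (S \ T) (sumOut (R \ S) f) = sumOut (R \ T) f := by
  rw [sumOut_union]
  · congr 1
    ext v
    have := @hTS v
    have := @hSR v
    simp only [Finset.mem_union, Finset.mem_sdiff]
    tauto
  · exact Finset.disjoint_left.mpr fun v hv hv' =>
      (Finset.mem_sdiff.mp hv').2 (Finset.mem_sdiff.mp hv).1

/-- If `f` and `g` share random variables with each other only inside `R`, then eliminating what
lies outside `R` from each of them before they are combined with a factor over `R` loses nothing. -/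
theorem sumOut_mul_sumOut_mul_sumOut {R X Y T : Finset (GroundRV V τ)} {k f g : Factor V τ}
    (hk : DependsOn k R) (hf : DependsOn f X) (hg : DependsOn g Y)
    (hXY : ∀ v ∈ X, v ∈ Y → v ∈ R) (hT : T ⊆ R) :
    sumOut (R \ T) (k * (sumOut (X \ R) f * sumOut (Y \ R) g)) =
      sumOut ((X ∪ R ∪ Y) \ T) (k * (f * g)) := by
  rw [← sumOut_mul_right (dependsOn_sumOut hg), ← sumOut_mul_left hf, sumOut_union,
    ← sumOut_mul_left hk, sumOut_union]
  · congr 1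
    ext v
    have := @hT v
    simp only [Finset.mem_union, Finset.mem_sdiff]
    tauto
  · rw [Finset.disjoint_left]
    intro v
    simp only [Finset.mem_union, Finset.mem_sdiff]
    tauto
  · intro v hv
    rw [Finset.mem_coe] at hv
    simp [hv]
  · rw [Finset.disjoint_left]
    intro v
    have := hXY v
    simp only [Finset.mem_sdiff]
    tauto
  · intro v hv
    have := hXY v
    rw [Finset.mem_coe] at hv
    simp only [Finset.mem_sdiff]
    tauto
  · intro v hv
    have := hXY v
    simp only [Set.mem_sdiff, Finset.mem_coe, Finset.mem_sdiff] at hv ⊢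
    tauto

/-- Distributivity: sums over disjoint sets of random variables, each of which is mentioned by its
own factor only, may be carried out factor by factor. -/
theorem prod_sumOut {ι : Type*} [DecidableEq ι] (K : Finset ι) (S : ι → Finset (GroundRV V τ))
    (U : ι → Set (GroundRV V τ)) (f : ι → Factor V τ) (hf : ∀ k ∈ K, DependsOn (f k) (U k))
    (hSU : ∀ k ∈ K, ∀ v ∈ S k, v ∈ U k)
    (h : ∀ k ∈ K, ∀ l ∈ K, k ≠ l → ∀ v ∈ U k, v ∉ S l) :
    ∏ k ∈ K, sumOut (S k) (f k) = sumOut (K.biUnion S) (∏ k ∈ K, f k) := by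
  induction K using Finset.induction_on with
  | empty => simp [sumOut_empty]
  | insert a K ha ih =>
    have hne : ∀ l ∈ K, a ≠ l := fun l hl e => ha (e ▸ hl)
    rw [Finset.prod_insert ha, Finset.prod_insert ha, Finset.biUnion_insert,
      ih (fun k hk => hf k (Finset.mem_insert_of_mem hk))
        (fun k hk => hSU k (Finset.mem_insert_of_mem hk))
        (fun k hk l hl => h k (Finset.mem_insert_of_mem hk) l (Finset.mem_insert_of_mem hl))]
    rw [← sumOut_union, sumOut_mul_left (hf a (Finset.mem_insert_self _ _)),
      sumOut_mul_right (U := ⋃ k ∈ K, (U k \ S k))]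
    · intro x y hxy
      rw [← ih (fun k hk => hf k (Finset.mem_insert_of_mem hk))
        (fun k hk => hSU k (Finset.mem_insert_of_mem hk))
        (fun k hk l hl => h k (Finset.mem_insert_of_mem hk) l (Finset.mem_insert_of_mem hl))]
      exact dependsOn_prod (fun k hk =>
        (dependsOn_sumOut (hf k (Finset.mem_insert_of_mem hk))).mono
          (Set.subset_biUnion_of_mem (u := fun k => U k \ (S k : Set (GroundRV V τ))) hk)) hxy
    · intro v hv
      simp only [Set.mem_iUnion] at hv
      obtain ⟨k, hk, hv, -⟩ := hv
      exact h k (Finset.mem_insert_of_mem hk) a (Finset.mem_insert_self _ _) (hne k hk).symm v hv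
    · intro v hv hv'
      obtain ⟨l, hl, hv'⟩ := Finset.mem_biUnion.mp hv'
      exact h a (Finset.mem_insert_self _ _) l (Finset.mem_insert_of_mem hl) (hne l hl) v hv hv'
    · rw [Finset.disjoint_left]
      intro v hv hv'
      obtain ⟨l, hl, hv'⟩ := Finset.mem_biUnion.mp hv'
      exact h a (Finset.mem_insert_self _ _) l (Finset.mem_insert_of_mem hl) (hne l hl) v
        (hSU a (Finset.mem_insert_self _ _) v hv) hv'

/-- Summing out random variables that a factor does not mention multiplies it by the number of
their joint values. -/
theorem sumOut_eq_smul {S : Finset (GroundRV V τ)} {U : Set (GroundRV V τ)} {f : Factor V τ}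
    (hf : DependsOn f U) (h : ∀ v ∈ U, v ∉ S) :
    sumOut S f = fun x => (Fintype.card (∀ v : S, V.range v.1.symbol) : ℝ≥0) * f x := by
  have := sumOut_mul_right hf h 1
  rw [one_mul] at this
  rw [this]
  funext x
  simp [sumOut]

theorem sumOut_const_mul (S : Finset (GroundRV V τ)) (c : ℝ≥0) (f : Factor V τ)
    (x : Assignment V τ) : sumOut S (fun y => c * f y) x = c * sumOut S f x := by
  simp only [sumOut, Finset.mul_sum]

theorem sumOut_singleton (v : GroundRV V τ) (f : Factor V τ) (x : Assignment V τ) :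
    sumOut {v} f x = ∑ b : V.range v.symbol, f (Function.update x v b) := by
  simp only [sumOut]
  refine Fintype.sum_equiv
    (Equiv.piUnique fun i : ({v} : Finset (GroundRV V τ)) => V.range i.1.symbol) _ _ fun y => ?_
  rw [Function.updateFinset_singleton]
  rfl

end SumOut

/-! ### The two sides of an edge of a tree -/

section TreeSides

variable {W : Type*} {G : SimpleGraph W}

/-- The first step of a path in a tree is determined by its end points. -/
theorem eq_of_adj_of_dist_lt (hG : G.IsTree) {i j k l : W} (hj : G.Adj i j) (hk : G.Adj i k)
    (hjl : G.dist j l < G.dist i l) (hkl : G.dist k l < G.dist i l) : j = k := by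
  have aux : ∀ {m : W}, G.Adj i m → G.dist m l < G.dist i l →
      ∃ (hm : G.Adj i m) (p : G.Walk m l), (SimpleGraph.Walk.cons hm p).IsPath := by
    intro m hm hml
    obtain ⟨p, hp⟩ := hG.connected.exists_walk_length_eq_dist m l
    refine ⟨hm, p, SimpleGraph.Walk.isPath_of_length_eq_dist _ ?_⟩
    have := G.dist_le (SimpleGraph.Walk.cons hm p)
    rw [SimpleGraph.Walk.length_cons] at this ⊢
    omega
  obtain ⟨hm, p, hp⟩ := aux hj hjl
  obtain ⟨hm', q, hq⟩ := aux hk hkl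
  have := (hG.existsUnique_path i l).unique hp hq
  injection this

theorem exists_adj_dist_lt (hG : G.IsTree) {i l : W} (h : i ≠ l) :
    ∃ k, G.Adj i k ∧ G.dist k l < G.dist i l := by
  obtain ⟨p, hp⟩ := hG.connected.exists_walk_length_eq_dist i l
  cases p with
  | nil => exact absurd rfl h
  | @cons _ k _ hk q =>
    refine ⟨k, hk, ?_⟩
    have := G.dist_le q
    rw [SimpleGraph.Walk.length_cons] at hp
    omega

/-- A walk between the two sides of an edge of a tree uses that edge. -/
theorem mem_support_of_dist_lt (hG : G.IsTree) {i j a b : W} (hij : G.Adj i j)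
    (ha : G.dist i a < G.dist j a) (hb : G.dist j b < G.dist i b) (p : G.Walk a b) :
    i ∈ p.support ∧ j ∈ p.support := by
  obtain ⟨d, hd, hx, hy⟩ := p.exists_boundary_dart {l | G.dist i l < G.dist j l} ha
    (by simpa using hb.le)
  obtain ⟨⟨x, y⟩, hxy⟩ := d
  simp only [Set.mem_ofPred_eq, not_lt] at hx hy hxy
  have e1 := hG.dist_eq_dist_add_one_of_adj x hij
  have e2 := hG.dist_eq_dist_add_one_of_adj y hij
  have e3 := hG.dist_eq_dist_add_one_of_adj i hxy
  have e4 := hG.dist_eq_dist_add_one_of_adj j hxy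
  simp only [G.dist_comm (u := x), G.dist_comm (u := y)] at e1 e2
  -- The boundary is crossed by an edge `x y` with `x` as far from `i` as `y` is from `j`.  If `x`
  -- were not `i`, then `y` and the first step from `x` to `i` would both lead from `x` towards `j`.
  have hxi : i = x := by
    by_contra hne
    obtain ⟨x', hx', hlt⟩ := exists_adj_dist_lt hG (Ne.symm hne)
    have e5 := hG.dist_eq_dist_add_one_of_adj j hx'
    have e6 := hG.connected.dist_triangle (u := j) (v := i) (w := x')
    have e7 : G.dist j i = 1 := SimpleGraph.dist_eq_one_iff_adj.mpr hij.symm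
    rw [G.dist_comm, G.dist_comm (u := x)] at hlt
    have : x' = y := eq_of_adj_of_dist_lt hG hx' hxy (l := j)
      (by rw [G.dist_comm, G.dist_comm (u := x)]; omega)
      (by rw [G.dist_comm, G.dist_comm (u := x)]; omega)
    subst this
    omega
  have hyj : j = y := by
    rw [← hG.connected.dist_eq_zero_iff]
    rw [← hG.connected.dist_eq_zero_iff] at hxi
    omega
  exact ⟨hxi ▸ p.dart_fst_mem_support_of_mem_darts hd,
    hyj ▸ p.dart_snd_mem_support_of_mem_darts hd⟩

variable [Fintype W]

open Classical in
/-- The vertices on the side of `i` of the edge `i j` of a tree. -/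
noncomputable def side (G : SimpleGraph W) (i j : W) : Finset W :=
  {l | G.dist i l < G.dist j l}

theorem mem_side {i j l : W} : l ∈ side G i j ↔ G.dist i l < G.dist j l := by
  simp [side]

theorem self_mem_side {i j : W} (h : G.Adj i j) : i ∈ side G i j := by
  simp [mem_side, SimpleGraph.dist_eq_one_iff_adj.mpr h.symm]

theorem notMem_side_self {i j : W} : j ∉ side G i j := by
  simp [mem_side]

/-- The branches at a vertex of a tree are disjoint. -/
theorem eq_of_mem_side (hG : G.IsTree) {i j k l : W} (hj : G.Adj j i) (hk : G.Adj k i)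
    (hjl : l ∈ side G j i) (hkl : l ∈ side G k i) : j = k :=
  eq_of_adj_of_dist_lt hG hj.symm hk.symm (mem_side.mp hjl) (mem_side.mp hkl)

theorem notMem_side_iff (hG : G.IsTree) {i j l : W} (h : G.Adj i j) :
    l ∉ side G i j ↔ l ∈ side G j i := by
  have := hG.dist_eq_dist_add_one_of_adj l h
  rw [G.dist_comm, G.dist_comm (u := l)] at this
  rw [mem_side, mem_side]
  omega

/-- A vertex together with its branches makes up the whole tree. -/
theorem insert_biUnion_side [DecidableEq W] (hG : G.IsTree) {i : W} {K : Finset W}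
    (hK : ∀ k, k ∈ K ↔ G.Adj k i) :
    insert i (K.biUnion fun k => side G k i) = Finset.univ := by
  ext l
  simp only [Finset.mem_insert, Finset.mem_biUnion, Finset.mem_univ, iff_true, hK]
  by_cases h : l = i
  · exact Or.inl h
  · obtain ⟨k, hk, hlt⟩ := exists_adj_dist_lt hG (Ne.symm h)
    exact Or.inr ⟨k, hk.symm, mem_side.mpr hlt⟩

/-- The side of `i` of the edge `i j` consists of `i` and its branches other than that of `j`. -/
theorem insert_biUnion_side_ne [DecidableEq W] (hG : G.IsTree) {i j : W} (hij : G.Adj i j)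
    {K : Finset W} (hK : ∀ k, k ∈ K ↔ G.Adj k i ∧ k ≠ j) :
    insert i (K.biUnion fun k => side G k i) = side G i j := by
  ext l
  simp only [Finset.mem_insert, Finset.mem_biUnion, hK]
  constructor
  · rintro (rfl | ⟨k, ⟨hk, hkj⟩, hl⟩)
    · exact self_mem_side hij
    · by_contra hn
      exact hkj (eq_of_mem_side hG hk hij.symm hl ((notMem_side_iff hG hij).mp hn))
  · intro hl
    by_cases h : l = i
    · exact Or.inl h
    · obtain ⟨k, hk, hlt⟩ := exists_adj_dist_lt hG (Ne.symm h)
      refine Or.inr ⟨k, ⟨hk.symm, ?_⟩, mem_side.mpr hlt⟩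
      rintro rfl
      exact (notMem_side_iff hG hij).mpr (mem_side.mpr hlt) hl

theorem dist_lt_card (hG : G.IsTree) (i j : W) : G.dist i j < Fintype.card W := by
  obtain ⟨p, hp, hl⟩ := hG.connected.exists_path_of_dist i j
  rw [← hl]
  exact hp.length_lt

end TreeSides

/-! ### Message passing on a junction tree -/

namespace ParclusterGraph

variable {V : Vocabulary} {τ : Type} (J : ParclusterGraph V τ)

/-- The conditions on the shape of a parcluster graph under which message passing is exact, without
reference to the model that the local models come from. -/
structure IsJunctionTree : Prop where
  isTree : J.graph.IsTree
  runningIntersection : ∀ (i j k : Fin J.size) (p : J.graph.Walk i j), p.IsPath → k ∈ p.support →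
    ∀ v ∈ (J.cluster i).groundRVs, v ∈ (J.cluster j).groundRVs → v ∈ (J.cluster k).groundRVs

/-- The ground random variables of a set of parclusters. -/
noncomputable def scope (T : Finset (Fin J.size)) : Finset (GroundRV V τ) :=
  T.biUnion fun i => (J.cluster i).groundRVs

/-- The correct message from `i` to `j`: everything on the side of `i`, with all random variables
outside `j` summed out. -/
noncomputable def exactMessage (c : Fin J.size → Factor V τ) (i j : Fin J.size) : Factor V τ :=
  sumOut (J.scope (side J.graph i j) \ (J.cluster j).groundRVs) (∏ l ∈ side J.graph i j, c l)

variable {J} {c c' : Fin J.size → Factor V τ} {m : J.Messages} {i j r : Fin J.size}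

theorem exactMessage_congr (h : ∀ l ∈ side J.graph i j, c l = c' l) :
    J.exactMessage c i j = J.exactMessage c' i j := by
  unfold exactMessage
  rw [Finset.prod_congr rfl h]

/-- A random variable that occurs on both sides of an edge belongs to its separator. -/
theorem IsJunctionTree.mem_separator (hJ : J.IsJunctionTree) (hij : J.graph.Adj i j)
    {a b : Fin J.size} (ha : a ∈ side J.graph i j) (hb : b ∉ side J.graph i j) {v : GroundRV V τ}
    (hva : v ∈ (J.cluster a).groundRVs) (hvb : v ∈ (J.cluster b).groundRVs) :
    v ∈ (J.cluster i).groundRVs ∧ v ∈ (J.cluster j).groundRVs := by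
  obtain ⟨p, hp, -⟩ := hJ.isTree.connected.exists_path_of_dist a b
  have := mem_support_of_dist_lt hJ.isTree hij (mem_side.mp ha)
    (mem_side.mp ((notMem_side_iff hJ.isTree hij).mp hb)) p
  exact ⟨hJ.runningIntersection a b i p hp this.1 v hva hvb,
    hJ.runningIntersection a b j p hp this.2 v hva hvb⟩

theorem dependsOn_prod_scope (hc : ∀ i, DependsOn (c i) (J.cluster i).groundRVs)
    (T : Finset (Fin J.size)) : DependsOn (∏ l ∈ T, c l) (J.scope T) :=
  dependsOn_prod fun l hl => (hc l).mono fun _ hv => Finset.mem_biUnion.mpr ⟨l, hl, hv⟩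

/-- The product of a content and correct incoming messages from some of the branches is the product
of all contents in these branches, with everything outside the parcluster summed out. -/
theorem IsJunctionTree.mul_prod_exactMessage (hJ : J.IsJunctionTree)
    (hc : ∀ i, DependsOn (c i) (J.cluster i).groundRVs) {K : Finset (Fin J.size)}
    (hK : ∀ k ∈ K, J.graph.Adj k i) :
    c i * ∏ k ∈ K, J.exactMessage c k i =
      sumOut (J.scope (insert i (K.biUnion fun k => side J.graph k i)) \ (J.cluster i).groundRVs)
        (∏ l ∈ insert i (K.biUnion fun k => side J.graph k i), c l) := by
  have hi : i ∉ K.biUnion fun k => side J.graph k i := fun h => by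
    obtain ⟨k, -, hk⟩ := Finset.mem_biUnion.mp h
    exact notMem_side_self hk
  have hdisj : ∀ k ∈ K, ∀ l ∈ K, k ≠ l → ∀ b ∈ side J.graph l i, b ∉ side J.graph k i :=
    fun k hk l hl hkl b hb hb' => hkl (eq_of_mem_side hJ.isTree (hK k hk) (hK l hl) hb' hb)
  have hset : J.scope (insert i (K.biUnion fun k => side J.graph k i)) \ (J.cluster i).groundRVs =
      K.biUnion fun k => J.scope (side J.graph k i) \ (J.cluster i).groundRVs := by
    ext v
    simp only [scope, Finset.mem_sdiff, Finset.mem_biUnion, Finset.mem_insert]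
    constructor
    · rintro ⟨⟨l, rfl | ⟨k, hk, hl⟩, hv⟩, hn⟩
      · exact absurd hv hn
      · exact ⟨k, hk, ⟨l, hl, hv⟩, hn⟩
    · rintro ⟨k, hk, ⟨l, hl, hv⟩, hn⟩
      exact ⟨⟨l, Or.inr ⟨k, hk, hl⟩, hv⟩, hn⟩
  rw [hset, Finset.prod_insert hi, Finset.prod_biUnion, sumOut_mul_left (hc i)]
  · congr 1
    refine prod_sumOut K _ (fun k => J.scope (side J.graph k i)) _
      (fun k _ => dependsOn_prod_scope hc _) (fun k _ v hv => (Finset.mem_sdiff.mp hv).1) ?_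
    intro k hk l hl hkl v hv hv'
    obtain ⟨hv', hn⟩ := Finset.mem_sdiff.mp hv'
    obtain ⟨a, ha, hva⟩ := Finset.mem_biUnion.mp hv
    obtain ⟨b, hb, hvb⟩ := Finset.mem_biUnion.mp hv'
    exact hn (hJ.mem_separator (hK k hk) ha (hdisj k hk l hl hkl b hb) hva hvb).2
  · intro v hv hv'
    obtain ⟨k, -, hk⟩ := Finset.mem_biUnion.mp hv'
    exact (Finset.mem_sdiff.mp hk).2 hv
  · intro k hk l hl hkl
    exact Finset.disjoint_left.mpr fun b hb hb' => hdisj k hk l hl hkl b hb' hb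

/-- A message computed from correct messages is correct. -/
theorem IsJunctionTree.message_eq (hJ : J.IsJunctionTree)
    (hc : ∀ i, DependsOn (c i) (J.cluster i).groundRVs) (hij : J.graph.Adj i j)
    (hm : ∀ k, J.graph.Adj k i → k ≠ j → m k i = J.exactMessage c k i) :
    J.message c m i j = J.exactMessage c i j := by
  classical
  unfold message
  rw [Finset.prod_congr rfl (g := fun k => J.exactMessage c k i)
      (fun k hk => hm k (Finset.mem_filter.mp hk).2.1 (Finset.mem_filter.mp hk).2.2),
    hJ.mul_prod_exactMessage hc (fun k hk => (Finset.mem_filter.mp hk).2.1)]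
  rw [insert_biUnion_side_ne hJ.isTree hij (by simp), sumOut_union, exactMessage]
  · congr 1
    ext v
    simp only [Finset.mem_union, Finset.mem_sdiff]
    constructor
    · rintro (⟨h, hn⟩ | ⟨h, hn⟩)
      · exact ⟨Finset.mem_biUnion.mpr ⟨i, self_mem_side hij, h⟩, hn⟩
      · refine ⟨h, fun hj => hn ?_⟩
        obtain ⟨a, ha, hva⟩ := Finset.mem_biUnion.mp h
        exact (hJ.mem_separator hij ha notMem_side_self hva hj).1
    · rintro ⟨h, hn⟩
      by_cases hi : v ∈ (J.cluster i).groundRVs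
      · exact Or.inl ⟨hi, hn⟩
      · exact Or.inr ⟨h, hi⟩
  · exact Finset.disjoint_left.mpr fun v hv hv' =>
      (Finset.mem_sdiff.mp hv').2 (Finset.mem_sdiff.mp hv).1

/-- The belief at `i` is correct if the incoming messages are; the messages towards `i` do not
involve the content of `i`, which may therefore be exchanged afterwards. -/
theorem IsJunctionTree.belief_eq (hJ : J.IsJunctionTree)
    (hc : ∀ i, DependsOn (c i) (J.cluster i).groundRVs) (hcc' : ∀ l, l ≠ i → c' l = c l)
    (hm : ∀ k, J.graph.Adj k i → m k i = J.exactMessage c' k i) :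
    J.belief c m i = sumOut (J.groundRVs \ (J.cluster i).groundRVs) (∏ l, c l) := by
  classical
  have hm' : ∀ k, J.graph.Adj k i → m k i = J.exactMessage c k i := fun k hk => by
    rw [hm k hk]
    exact exactMessage_congr fun l hl => hcc' l fun e => notMem_side_self (e ▸ hl)
  unfold belief
  rw [Finset.prod_congr rfl (g := fun k => J.exactMessage c k i)
      (fun k hk => hm' k (Finset.mem_filter.mp hk).2),
    hJ.mul_prod_exactMessage hc (fun k hk => (Finset.mem_filter.mp hk).2)]
  rw [insert_biUnion_side hJ.isTree (by simp)]
  rfl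

/-- All messages towards `r` are correct. -/
def InboundExact (c : Fin J.size → Factor V τ) (r : Fin J.size) (m : J.Messages) : Prop :=
  ∀ i j, J.graph.Adj i j → J.graph.dist r i = J.graph.dist r j + 1 → m i j = J.exactMessage c i j

theorem IsJunctionTree.inboundExact_inboundPass (hJ : J.IsJunctionTree)
    (hc : ∀ i, DependsOn (c i) (J.cluster i).groundRVs) (r : Fin J.size) (m : J.Messages) :
    InboundExact c r (J.inboundPass c r m) := by
  classical
  -- The messages to the distances `n` and above are correct before the rounds below `n` are run.
  have key : ∀ (n : ℕ) (m : J.Messages),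
      (∀ i j, J.graph.Adj i j → J.graph.dist r i = J.graph.dist r j + 1 → n ≤ J.graph.dist r j →
        m i j = J.exactMessage c i j) →
      InboundExact c r ((List.range n).reverse.foldl (fun m d => fun i j =>
        if J.graph.Adj i j ∧ J.graph.dist r i = d + 1 ∧ J.graph.dist r j = d then
          J.message c m i j else m i j) m) := by
    intro n
    induction n with
    | zero => exact fun m h i j hij hd => h i j hij hd (Nat.zero_le _)
    | succ n ih =>
      intro m h
      rw [List.range_succ, List.reverse_append, List.reverse_singleton, List.singleton_append,
        List.foldl_cons]
      refine ih _ fun i j hij hd hn => ?_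
      split_ifs with hcond
      · refine hJ.message_eq hc hij fun k hki hkj => h k i hki ?_ (by omega)
        rcases hJ.isTree.dist_eq_dist_add_one_of_adj r hki with h1 | h1
        · exact h1
        · refine absurd (eq_of_adj_of_dist_lt hJ.isTree hki.symm hij (l := r) ?_ ?_) hkj <;>
            rw [J.graph.dist_comm, J.graph.dist_comm (u := i)] <;> omega
      · refine h i j hij hd ?_
        by_contra hlt
        exact hcond ⟨hij, by omega, by omega⟩
  refine key J.size m fun i j _ _ hn => ?_
  have := dist_lt_card hJ.isTree r j
  rw [Fintype.card_fin] at this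
  omega

/-- An outbound message depends on an earlier outbound message and on inbound messages to its
sender, which an outbound pass leaves alone. -/
theorem IsJunctionTree.outboundPass_eq (hJ : J.IsJunctionTree)
    (hc : ∀ i, DependsOn (c i) (J.cluster i).groundRVs) (hm : InboundExact c r m)
    (hij : J.graph.Adj i j) : J.outboundPass c r m i j = J.exactMessage c i j := by
  classical
  -- After the rounds below `n`, the inbound messages and the messages from the distances below `n`
  -- are correct.
  have key : ∀ n : ℕ, ∀ i j, J.graph.Adj i j →
      J.graph.dist r i = J.graph.dist r j + 1 ∨
        (J.graph.dist r j = J.graph.dist r i + 1 ∧ J.graph.dist r i < n) →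
      (List.range n).foldl (fun m d => fun i j =>
        if J.graph.Adj i j ∧ J.graph.dist r i = d ∧ J.graph.dist r j = d + 1 then
          J.message c m i j else m i j) m i j = J.exactMessage c i j := by
    intro n
    induction n with
    | zero => exact fun i j hij h => hm i j hij (h.resolve_right fun h => by omega)
    | succ n ih =>
      intro i j hij h
      rw [List.range_succ, List.foldl_append, List.foldl_cons, List.foldl_nil]
      split_ifs with hcond
      · refine hJ.message_eq hc hij fun k hki hkj => ih k i hki ?_
        rcases hJ.isTree.dist_eq_dist_add_one_of_adj r hki with h1 | h1
        · exact Or.inl h1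
        · exact Or.inr ⟨h1, by omega⟩
      · refine ih i j hij (h.imp_right fun h => ⟨h.1, ?_⟩)
        by_contra hlt
        exact hcond ⟨hij, by omega, by omega⟩
  refine key J.size i j hij ?_
  have := dist_lt_card hJ.isTree r i
  rw [Fintype.card_fin] at this
  rcases hJ.isTree.dist_eq_dist_add_one_of_adj r hij with h | h
  · exact Or.inl h
  · exact Or.inr ⟨h, this⟩

/-- After a complete message pass, all messages are correct. -/
theorem IsJunctionTree.passMessages_eq (hJ : J.IsJunctionTree)
    (hc : ∀ i, DependsOn (c i) (J.cluster i).groundRVs) (hij : J.graph.Adj i j) :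
    J.passMessages c r i j = J.exactMessage c i j :=
  hJ.outboundPass_eq hc (hJ.inboundExact_inboundPass hc r 1) hij

/-- If the content of `r` alone has changed, then the messages towards `r` remain correct, and an
outbound pass from `r` corrects the others. -/
theorem IsJunctionTree.outboundPass_eq_of_change (hJ : J.IsJunctionTree)
    (hc : ∀ i, DependsOn (c i) (J.cluster i).groundRVs) (hcc' : ∀ l, l ≠ r → c' l = c l)
    (hm : ∀ i j, J.graph.Adj i j → m i j = J.exactMessage c' i j) (hij : J.graph.Adj i j) :
    J.outboundPass c r m i j = J.exactMessage c i j := by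
  refine hJ.outboundPass_eq hc (fun i j hij hd => ?_) hij
  rw [hm i j hij]
  refine exactMessage_congr fun l hl => hcc' l ?_
  rintro rfl
  rw [mem_side, J.graph.dist_comm, J.graph.dist_comm (u := j)] at hl
  omega

end ParclusterGraph

/-! ### Ground random variables and weights of models -/

section Grounding

variable {V : Vocabulary} {τ σ : Type}

/-- Move a ground random variable to another slice. -/
def GroundRV.map (f : τ → σ) (v : GroundRV V τ) : GroundRV V σ := ⟨v.symbol, v.consts, f v.time⟩

theorem GroundRV.map_injective {f : τ → σ} (hf : f.Injective) :
    (GroundRV.map f : GroundRV V τ → GroundRV V σ).Injective := by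
  rintro ⟨P, c, s⟩ ⟨P', c', s'⟩ h
  simp only [GroundRV.map, GroundRV.mk.injEq] at h
  obtain ⟨rfl, rfl, h⟩ := h
  rw [hf h]

theorem Parcluster.mem_groundRVs {C : Parcluster V τ} {v : GroundRV V τ} :
    v ∈ C.groundRVs ↔ ∃ θ ∈ C.constr, ∃ (B : PRV V τ) (hB : B ∈ C.prvs),
      B.ground C.logvars (C.prvs_logvars B hB) θ = v := by
  simp [Parcluster.groundRVs]

theorem Parcluster.groundRVs_map (f : τ → σ) (C : Parcluster V τ) :
    (C.map f).groundRVs = C.groundRVs.image (GroundRV.map f) := by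
  ext v
  simp only [Finset.mem_image, Parcluster.mem_groundRVs]
  constructor
  · rintro ⟨θ, hθ, B, hB, rfl⟩
    obtain ⟨B', hB', rfl⟩ := Finset.mem_image.mp hB
    exact ⟨_, ⟨θ, hθ, B', hB', rfl⟩, rfl⟩
  · rintro ⟨_, ⟨θ, hθ, B, hB, rfl⟩, rfl⟩
    exact ⟨θ, hθ, B.map f, Finset.mem_image_of_mem _ hB, rfl⟩

theorem Parfactor.mem_groundRVs {g : Parfactor V τ} {v : GroundRV V τ} :
    v ∈ g.groundRVs ↔ ∃ θ ∈ g.constr, ∃ i, g.groundArg θ i = v := by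
  simp [Parfactor.groundRVs]

theorem Parfactor.groundRVs_map (f : τ → σ) (g : Parfactor V τ) :
    (g.map f).groundRVs = g.groundRVs.image (GroundRV.map f) := by
  ext v
  simp only [Finset.mem_image, Parfactor.mem_groundRVs]
  constructor
  · rintro ⟨θ, hθ, i, rfl⟩
    exact ⟨_, ⟨θ, hθ, i, rfl⟩, rfl⟩
  · rintro ⟨_, ⟨θ, hθ, i, rfl⟩, rfl⟩
    exact ⟨θ, hθ, i, rfl⟩

theorem Parfactor.dependsOn_weight (g : Parfactor V τ) : DependsOn g.weight g.groundRVs := by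
  intro x y h
  refine Finset.prod_congr rfl fun θ hθ => ?_
  congr 1
  funext i
  exact h _ (Parfactor.mem_groundRVs.mpr ⟨θ, hθ, i, rfl⟩)

namespace PM

theorem mem_groundRVs {G : PM V τ} {v : GroundRV V τ} :
    v ∈ PM.groundRVs G ↔ ∃ g ∈ G, v ∈ g.groundRVs := by
  unfold PM.groundRVs
  induction G using Multiset.induction_on with
  | empty => simp
  | cons g G ih => simp [ih]

theorem mem_groundRVs_sum {ι : Type*} {s : Finset ι} {G : ι → PM V τ} {v : GroundRV V τ} :
    v ∈ PM.groundRVs (∑ i ∈ s, G i) ↔ ∃ i ∈ s, v ∈ PM.groundRVs (G i) := by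
  simp only [mem_groundRVs, Multiset.mem_sum]
  constructor
  · rintro ⟨g, ⟨i, hi, hg⟩, hv⟩
    exact ⟨i, hi, g, hg, hv⟩
  · rintro ⟨i, hi, g, hg, hv⟩
    exact ⟨g, ⟨i, hi, hg⟩, hv⟩

theorem weight_add (G H : PM V τ) : PM.weight (G + H) = PM.weight G * PM.weight H := by
  funext x
  simp [PM.weight]

theorem weight_sum {ι : Type*} (s : Finset ι) (G : ι → PM V τ) :
    PM.weight (∑ i ∈ s, G i) = ∏ i ∈ s, PM.weight (G i) := by
  classical
  induction s using Finset.induction_on with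
  | empty => funext x; simp [PM.weight]
  | insert i s hi ih => rw [Finset.sum_insert hi, Finset.prod_insert hi, weight_add, ih]

theorem dependsOn_weight (G : PM V τ) : DependsOn (PM.weight G) (PM.groundRVs G) := by
  intro x y h
  unfold PM.weight
  congr 1
  exact Multiset.map_congr rfl fun g hg =>
    g.dependsOn_weight fun v hv => h v (mem_groundRVs.mpr ⟨g, hg, hv⟩)

end PM

theorem ParclusterGraph.IsFOJTree.isJunctionTree_map {J : ParclusterGraph V τ} {G : PM V τ}
    (h : J.IsFOJTree G) {f : τ → σ} (hf : f.Injective) : (J.map f).IsJunctionTree where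
  isTree := h.isTree
  runningIntersection := by
    intro i j k p hp hk v hi hj
    change v ∈ ((J.cluster i).map f).groundRVs at hi
    change v ∈ ((J.cluster j).map f).groundRVs at hj
    change v ∈ ((J.cluster k).map f).groundRVs
    rw [Parcluster.groundRVs_map] at hi hj ⊢
    obtain ⟨u, hu, rfl⟩ := Finset.mem_image.mp hi
    obtain ⟨u', hu', he⟩ := Finset.mem_image.mp hj
    obtain rfl := GroundRV.map_injective hf he
    exact Finset.mem_image_of_mem _ (h.runningIntersection i j k p hp hk _ hu hu')

/-- The local models of a moved junction tree jointly carry the weight of the moved model. -/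
theorem ParclusterGraph.IsFOJTree.prod_weight_map {J : ParclusterGraph V τ} {G : PM V τ}
    (h : J.IsFOJTree G) (f : τ → σ) :
    ∏ i, PM.weight ((J.map f).localModel i) = PM.weight (G.map (Parfactor.map f)) := by
  rw [← h.assigned, ← PM.weight_sum]
  exact congrArg PM.weight (map_sum (Multiset.mapAddMonoidHom (Parfactor.map f)) _ _).symm

theorem ParclusterGraph.IsFOJTree.groundRVs_subset_map {J : ParclusterGraph V τ} {G : PM V τ}
    (h : J.IsFOJTree G) (f : τ → σ) (i : Fin J.size) :
    PM.groundRVs ((J.map f).localModel i) ⊆ ((J.map f).cluster i).groundRVs := by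
  intro v hv
  obtain ⟨g, hg, hv⟩ := PM.mem_groundRVs.mp hv
  obtain ⟨g, hg', rfl⟩ := Multiset.mem_map.mp hg
  change v ∈ ((J.cluster i).map f).groundRVs
  rw [Parfactor.groundRVs_map] at hv
  rw [Parcluster.groundRVs_map]
  exact Finset.image_subset_image (h.fits i g hg').2 hv

theorem ParclusterGraph.IsFOJTree.exists_mem_cluster_map {J : ParclusterGraph V τ} {G : PM V τ}
    (h : J.IsFOJTree G) (f : τ → σ) {v : GroundRV V σ}
    (hv : v ∈ PM.groundRVs (G.map (Parfactor.map f))) :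
    v ∈ (J.map f).groundRVs := by
  obtain ⟨g, hg, hv⟩ := PM.mem_groundRVs.mp hv
  obtain ⟨g, hg', rfl⟩ := Multiset.mem_map.mp hg
  rw [← h.assigned] at hg'
  obtain ⟨i, -, hi⟩ := Multiset.mem_sum.mp hg'
  exact Finset.mem_biUnion.mpr ⟨i, Finset.mem_univ _, h.groundRVs_subset_map f i
    (PM.mem_groundRVs.mpr ⟨_, Multiset.mem_map_of_mem _ hi, hv⟩)⟩

end Grounding

/-! ### The interface -/

section Interface

variable {V : Vocabulary} (D : PDM V) {τ σ : Type}

theorem PDM.time_of_mem_interfaceParfactor {c : τ} {v : GroundRV V τ}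
    (hv : v ∈ (D.interfaceParfactor c).groundRVs) : v.time = c := by
  obtain ⟨θ, -, i, rfl⟩ := Parfactor.mem_groundRVs.mp hv
  rfl

/-- The interface parfactor has every instance of an interface PRV, whatever the logical variables
that the instance was formed with. -/
theorem PDM.ground_mem_interfaceParfactor {c : τ} {B : PRV V τ}
    (hB : B.map (fun _ => ()) ∈ D.interface) (hc : B.time = c) {X : Finset V.LogVar}
    (hX : ∀ x ∈ B.args, x ∈ X) {θ : X → V.Const} (hθ : ∀ x : X, θ x ∈ V.dom x.1) :
    B.ground X hX θ ∈ (D.interfaceParfactor c).groundRVs := by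
  classical
  rw [Parfactor.mem_groundRVs]
  refine ⟨fun x => if h : x.1 ∈ X then θ ⟨x.1, h⟩ else (V.dom_nonempty x.1).choose,
    Fintype.mem_piFinset.mpr fun x => ?_, D.interface.equivFin ⟨_, hB⟩, ?_⟩
  · split_ifs with h
    · exact hθ ⟨x.1, h⟩
    · exact (V.dom_nonempty x.1).choose_spec
  · have hargs : (D.interfaceParfactor c).args (D.interface.equivFin ⟨_, hB⟩) = B := by
      subst hc
      simp [PDM.interfaceParfactor, PRV.map]
    have aux : ∀ (B' : PRV V τ) (h' : ∀ x ∈ B'.args, x ∈ (D.interfaceParfactor c).logvars),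
        B' = B → B'.ground (D.interfaceParfactor c).logvars h'
          (fun x => if h : x.1 ∈ X then θ ⟨x.1, h⟩ else (V.dom_nonempty x.1).choose) =
            B.ground X hX θ := by
      rintro _ h' rfl
      simp only [PRV.ground, GroundRV.mk.injEq, true_and, and_true]
      exact List.pmap_congr_left _ fun x hx _ _ => by simp [hX x hx]
    exact aux _ _ hargs

theorem PDM.weight_map_interfaceParfactor (c : τ) (f : τ → σ) :
    ((D.interfaceParfactor c).map f).weight = 1 := by
  funext x
  simp [Parfactor.weight, Parfactor.map, PDM.interfaceParfactor]

theorem PM.weight_map_add_interface (G : PM V τ) (c : τ) (f : τ → σ) :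
    PM.weight ((G + {D.interfaceParfactor c}).map (Parfactor.map f)) =
      PM.weight (G.map (Parfactor.map f)) := by
  rw [Multiset.map_add, PM.weight_add]
  have : PM.weight (({D.interfaceParfactor c} : PM V τ).map (Parfactor.map f)) = 1 := by
    funext x
    simp [PM.weight, D.weight_map_interfaceParfactor c f]
  rw [this, mul_one]

/-- The PRVs of the previous slice that occur in a tree for a time step are interface PRVs. -/
theorem PDM.IsStepTree.map_mem_interface {D : PDM V} {J : ParclusterGraph V TwoSlice}
    (h : D.IsStepTree J) {i : Fin J.size} {B : PRV V TwoSlice} (hB : B ∈ (J.cluster i).prvs)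
    (ht : B.time = TwoSlice.prev) : B.map (fun _ => ()) ∈ D.interface := by
  obtain ⟨g, hg, k, rfl⟩ := h.1.prvs_from i B hB
  rcases Multiset.mem_add.mp hg with hg | hg
  · rcases Multiset.mem_add.mp hg with hg | hg
    · obtain ⟨hg, hc⟩ := Multiset.mem_filter.mp hg
      refine (D.mem_interface _).mpr ⟨g, hg, ⟨k, ?_⟩, hc⟩
      simp [PRV.map, ← ht]
    · obtain rfl := Multiset.mem_singleton.mp hg
      exact (D.interface.equivFin.symm k).2
  · obtain rfl := Multiset.mem_singleton.mp hg
    exact absurd ht TwoSlice.noConfusion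

end Interface

/-! ### The junction trees of the time steps -/

namespace LDJT

variable {V : Vocabulary} {D : PDM V} (A : LDJT D)

theorem toTime_injective (s : ℕ) : (TwoSlice.toTime s).Injective := by
  rintro (_ | _) (_ | _) h <;> simp_all [TwoSlice.toTime]

theorem isJunctionTree : ∀ s, (A.tree s).IsJunctionTree
  | 0 => A.initialTree.1.isJunctionTree_map fun _ _ _ => rfl
  | s + 1 => A.stepTree.1.isJunctionTree_map (toTime_injective s)

theorem prod_weight_localModel :
    ∀ s, ∏ i, PM.weight ((A.tree s).localModel i) = PM.weight (D.modelAt s)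
  | 0 => (A.initialTree.1.prod_weight_map _).trans (PM.weight_map_add_interface D _ _ _)
  | _ + 1 => (A.stepTree.1.prod_weight_map _).trans
      ((PM.weight_map_add_interface D _ _ _).trans (PM.weight_map_add_interface D _ _ _))

theorem groundRVs_localModel_subset :
    ∀ (s : ℕ) (i : Fin (A.tree s).size),
      PM.groundRVs ((A.tree s).localModel i) ⊆ ((A.tree s).cluster i).groundRVs
  | 0 => A.initialTree.1.groundRVs_subset_map _
  | _ + 1 => A.stepTree.1.groundRVs_subset_map _

theorem groundRVs_modelAt_subset :
    ∀ s, PM.groundRVs (D.modelAt s) ⊆ (A.tree s).groundRVs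
  | 0 => fun v hv => A.initialTree.1.exists_mem_cluster_map _ (by
      obtain ⟨g, hg, hv⟩ := PM.mem_groundRVs.mp hv
      exact PM.mem_groundRVs.mpr
        ⟨g, Multiset.mem_of_le (Multiset.map_le_map (Multiset.le_add_right _ _)) hg, hv⟩)
  | s + 1 => fun v hv => A.stepTree.1.exists_mem_cluster_map _ (by
      obtain ⟨g, hg, hv⟩ := PM.mem_groundRVs.mp hv
      exact PM.mem_groundRVs.mpr ⟨g, Multiset.mem_of_le (Multiset.map_le_map
        ((Multiset.le_add_right _ _).trans (Multiset.le_add_right _ _))) hg, hv⟩)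

theorem time_of_mem_interfaceRVs {s : ℕ} {v : GroundRV V ℕ} (hv : v ∈ D.interfaceRVs s) :
    v.time = s :=
  D.time_of_mem_interfaceParfactor hv

theorem interfaceRVs_subset_outCluster :
    ∀ s, D.interfaceRVs s ⊆ ((A.tree s).cluster (A.tree s).outCluster).groundRVs
  | 0 => fun _ hv => A.initialTree.1.groundRVs_subset_map (fun _ => 0) _
      (PM.mem_groundRVs.mpr ⟨_, Multiset.mem_map_of_mem _ A.initialTree.2.1, hv⟩)
  | s + 1 => fun _ hv => A.stepTree.1.groundRVs_subset_map (TwoSlice.toTime s) _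
      (PM.mem_groundRVs.mpr ⟨_, Multiset.mem_map_of_mem _ A.stepTree.2.2, hv⟩)

theorem interfaceRVs_subset_inCluster (s : ℕ) :
    D.interfaceRVs s ⊆ ((A.tree (s + 1)).cluster (A.tree (s + 1)).inCluster).groundRVs :=
  fun _ hv => A.stepTree.1.groundRVs_subset_map (TwoSlice.toTime s) _
    (PM.mem_groundRVs.mpr ⟨_, Multiset.mem_map_of_mem _ A.stepTree.2.1, hv⟩)

theorem cluster_subset (s : ℕ) (i : Fin (A.tree s).size) :
    ((A.tree s).cluster i).groundRVs ⊆ (A.tree s).groundRVs :=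
  Finset.subset_biUnion_of_mem (fun i => ((A.tree s).cluster i).groundRVs) (Finset.mem_univ i)

/-- A tree for a time step meets the previous slice in interface random variables only. -/
theorem time_of_mem_tree_succ {s : ℕ} {v : GroundRV V ℕ} (hv : v ∈ (A.tree (s + 1)).groundRVs) :
    v ∈ D.interfaceRVs s ∨ v.time = s + 1 := by
  obtain ⟨i, -, hv⟩ := Finset.mem_biUnion.mp hv
  change v ∈ ((A.J₁.cluster i).map (TwoSlice.toTime s)).groundRVs at hv
  rw [Parcluster.groundRVs_map] at hv
  obtain ⟨u, hu, rfl⟩ := Finset.mem_image.mp hv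
  obtain ⟨θ, hθ, B, hB, rfl⟩ := Parcluster.mem_groundRVs.mp hu
  rcases ht : B.time with _ | _
  · left
    have := D.ground_mem_interfaceParfactor (A.stepTree.map_mem_interface hB ht) ht
      ((A.J₁.cluster i).prvs_logvars B hB) ((A.J₁.cluster i).constr_dom θ hθ)
    have h2 := Finset.mem_image_of_mem (GroundRV.map (TwoSlice.toTime s)) this
    rw [← Parfactor.groundRVs_map] at h2
    exact h2
  · right
    simp [GroundRV.map, PRV.ground, ht, TwoSlice.toTime]

theorem time_le_of_mem_tree : ∀ {s : ℕ} {v : GroundRV V ℕ}, v ∈ (A.tree s).groundRVs → v.time ≤ s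
  | 0, v, hv => by
    obtain ⟨i, -, hv⟩ := Finset.mem_biUnion.mp hv
    change v ∈ ((A.J₀.cluster i).map fun _ => 0).groundRVs at hv
    rw [Parcluster.groundRVs_map] at hv
    obtain ⟨u, -, rfl⟩ := Finset.mem_image.mp hv
    exact le_rfl
  | s + 1, v, hv => by
    rcases A.time_of_mem_tree_succ hv with h | h
    · have := time_of_mem_interfaceRVs h
      omega
    · exact h.le

/-- The trees of different time steps share random variables only if the steps are consecutive, and
then only those of the interface between them. -/
theorem mem_interfaceRVs_of_mem_tree {r s : ℕ} (hrs : r < s) {v : GroundRV V ℕ}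
    (hr : v ∈ (A.tree r).groundRVs) (hs : v ∈ (A.tree s).groundRVs) :
    s = r + 1 ∧ v ∈ D.interfaceRVs r := by
  obtain ⟨q, rfl⟩ : ∃ q, s = q + 1 := ⟨s - 1, by omega⟩
  have h1 := A.time_le_of_mem_tree hr
  rcases A.time_of_mem_tree_succ hs with h | h
  · have h2 := time_of_mem_interfaceRVs h
    obtain rfl : q = r := by omega
    exact ⟨rfl, h⟩
  · omega

/-- A random variable of slice `s` of the unrolled model belongs to the tree of step `s`, even if
only the next step contributes a parfactor with it. -/
theorem mem_tree_of_mem_unrolled {t : ℕ} {v : GroundRV V ℕ}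
    (hv : v ∈ PM.groundRVs (D.unrolled t)) : v ∈ (A.tree v.time).groundRVs := by
  obtain ⟨r, -, hv⟩ := PM.mem_groundRVs_sum.mp hv
  have h := A.groundRVs_modelAt_subset r hv
  rcases r with _ | r
  · have := A.time_le_of_mem_tree h
    rwa [Nat.le_zero.mp this]
  · rcases A.time_of_mem_tree_succ h with h' | h'
    · rw [time_of_mem_interfaceRVs h']
      exact A.cluster_subset r _ (A.interfaceRVs_subset_outCluster r h')
    · rwa [h']

end LDJT

/-! ### Exactness of the messages between time steps -/

section Agree

variable {V : Vocabulary}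

theorem dependsOn_agree (O : Finset (GroundRV V ℕ)) (e : Assignment V ℕ) :
    DependsOn (agree O e) O := by
  intro x y h
  have : (∀ v ∈ O, x v = e v) ↔ ∀ v ∈ O, y v = e v :=
    forall₂_congr fun v hv => by rw [h v hv]
  classical
  exact if_congr this rfl rfl

/-- Evidence that is entered in every parcluster with the observed random variable counts only
once, since an indicator is idempotent. -/
theorem prod_agree_inter {ι : Type*} [Fintype ι] (O : Finset (GroundRV V ℕ)) (e : Assignment V ℕ)
    (C : ι → Finset (GroundRV V ℕ)) (h : O ⊆ Finset.univ.biUnion C) :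
    ∏ i, agree (O ∩ C i) e = agree O e := by
  funext x
  simp only [Finset.prod_apply, agree]
  by_cases hx : ∀ v ∈ O, x v = e v
  · rw [if_pos hx]
    exact Finset.prod_eq_one fun i _ => if_pos fun v hv => hx v (Finset.mem_inter.mp hv).1
  · rw [if_neg hx]
    push Not at hx
    obtain ⟨v, hv, hne⟩ := hx
    obtain ⟨i, -, hi⟩ := Finset.mem_biUnion.mp (h hv)
    exact Finset.prod_eq_zero (Finset.mem_univ i)
      (if_neg fun hx => hne (hx v (Finset.mem_inter.mpr ⟨hv, hi⟩)))

end Agree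

namespace LDJT

variable {V : Vocabulary} {D : PDM V} (A : LDJT D) (E : Evidence V) {t : ℕ}

/-- What time step `s` contributes to the unrolled model, together with its evidence. -/
noncomputable def stepWeight (D : PDM V) (E : Evidence V) (s : ℕ) : Factor V ℕ :=
  PM.weight (D.modelAt s) * agree (E.obs s) E.val

/-- The ground random variables of the trees of the time steps in `T`. -/
noncomputable def span (T : Finset ℕ) : Finset (GroundRV V ℕ) :=
  T.biUnion fun r => (A.tree r).groundRVs

variable {E} {s : ℕ} {α β : Option (Factor V ℕ)}

theorem dependsOn_stepWeight (hE : E.obs s ⊆ (A.tree s).groundRVs) :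
    DependsOn (stepWeight D E s) (A.tree s).groundRVs :=
  dependsOn_mul ((PM.dependsOn_weight _).mono (A.groundRVs_modelAt_subset s))
    ((dependsOn_agree _ _).mono hE)

theorem dependsOn_prod_stepWeight {T : Finset ℕ}
    (hE : ∀ r ∈ T, E.obs r ⊆ (A.tree r).groundRVs) :
    DependsOn (∏ r ∈ T, stepWeight D E r) (A.span T) :=
  dependsOn_prod fun r hr => (A.dependsOn_stepWeight (hE r hr)).mono
    fun _ hv => Finset.mem_biUnion.mpr ⟨r, hr, hv⟩

theorem dependsOn_content
    (hα : DependsOn (α.getD 1) ((A.tree s).cluster (A.tree s).inCluster).groundRVs)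
    (hβ : DependsOn (β.getD 1) ((A.tree s).cluster (A.tree s).outCluster).groundRVs)
    (i : Fin (A.tree s).size) :
    DependsOn (A.content E s α β i) ((A.tree s).cluster i).groundRVs := by
  unfold content
  refine dependsOn_mul (dependsOn_mul (dependsOn_mul ?_ ?_) ?_) ?_
  · exact (PM.dependsOn_weight _).mono (A.groundRVs_localModel_subset s i)
  · exact (dependsOn_agree _ _).mono (by simp)
  · split_ifs with h
    · exact h ▸ hα
    · exact dependsOn_one _
  · split_ifs with h
    · exact h ▸ hβ
    · exact dependsOn_one _

theorem prod_content (hE : E.obs s ⊆ (A.tree s).groundRVs) :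
    ∏ i, A.content E s α β i = stepWeight D E s * (α.getD 1 * β.getD 1) := by
  classical
  unfold content
  rw [Finset.prod_mul_distrib, Finset.prod_mul_distrib, Finset.prod_mul_distrib,
    A.prod_weight_localModel, prod_agree_inter _ _ _ hE]
  simp only [Finset.prod_ite_eq', Finset.mem_univ, if_true]
  rw [stepWeight, mul_assoc]

theorem content_eq_of_ne_inCluster {i : Fin (A.tree s).size} (h : i ≠ (A.tree s).inCluster)
    (α' : Option (Factor V ℕ)) : A.content E s α β i = A.content E s α' β i := by
  simp [content, h]

theorem content_eq_of_ne_outCluster {i : Fin (A.tree s).size} (h : i ≠ (A.tree s).outCluster)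
    (β' : Option (Factor V ℕ)) : A.content E s α β i = A.content E s α β' i := by
  simp [content, h]

theorem dependsOn_getD_none {U : Set (GroundRV V ℕ)} :
    DependsOn ((none : Option (Factor V ℕ)).getD 1) U :=
  dependsOn_one U

/-! ### The forward pass -/

theorem forwardStep_eq
    (hα : DependsOn (α.getD 1) ((A.tree s).cluster (A.tree s).inCluster).groundRVs) :
    A.forwardStep E s α =
      sumOut ((A.tree s).groundRVs \ D.interfaceRVs s) (∏ i, A.content E s α none i) := by
  have hc := A.dependsOn_content (E := E) hα dependsOn_getD_none
  unfold forwardStep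
  rw [(A.isJunctionTree s).belief_eq (m := A.forwardMessages E s α) hc (fun _ _ => rfl)
      (fun k hk => (A.isJunctionTree s).passMessages_eq hc hk),
    sumOut_sdiff_sumOut_sdiff (A.interfaceRVs_subset_outCluster s) (A.cluster_subset s _)]

theorem dependsOn_forwardStep
    (hα : DependsOn (α.getD 1) ((A.tree s).cluster (A.tree s).inCluster).groundRVs) :
    DependsOn (A.forwardStep E s α) (D.interfaceRVs s) := by
  rw [A.forwardStep_eq hα]
  exact dependsOn_sumOut_sdiff (ParclusterGraph.dependsOn_prod_scope
    (A.dependsOn_content hα dependsOn_getD_none) Finset.univ)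

theorem alpha_eq : ∀ s, A.alpha E s = A.forwardStep E s (A.alphaIn E s)
  | 0 => rfl
  | _ + 1 => rfl

theorem dependsOn_alphaIn :
    ∀ s, DependsOn ((A.alphaIn E s).getD 1) ((A.tree s).cluster (A.tree s).inCluster).groundRVs
  | 0 => dependsOn_getD_none
  | s + 1 => by
    change DependsOn (A.alpha E s) _
    rw [alpha_eq]
    exact (A.dependsOn_forwardStep (dependsOn_alphaIn s)).mono (A.interfaceRVs_subset_inCluster s)

theorem span_insert (T : Finset ℕ) (s : ℕ) :
    A.span (insert s T) = (A.tree s).groundRVs ∪ A.span T :=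
  Finset.biUnion_insert

/-- The message `α_{s-1}` sums the contributions of all earlier time steps over all random variables
that do not belong to the tree of step `s`. -/
theorem alphaIn_eq (hE : ∀ r < s, E.obs r ⊆ (A.tree r).groundRVs) :
    (A.alphaIn E s).getD 1 =
      sumOut (A.span (Finset.range s) \ (A.tree s).groundRVs)
        (∏ r ∈ Finset.range s, stepWeight D E r) := by
  induction s with
  | zero => simp [alphaIn, span, sumOut_empty]
  | succ s ih =>
    change A.alpha E s = _
    rw [alpha_eq, A.forwardStep_eq (A.dependsOn_alphaIn s), A.prod_content (hE s (by omega)),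
      ih fun r hr => hE r (by omega)]
    have key := sumOut_mul_sumOut_mul_sumOut (Y := ∅) (g := 1)
      (A.dependsOn_stepWeight (hE s (by omega)))
      (A.dependsOn_prod_stepWeight (T := Finset.range s)
        fun r hr => hE r (by have := Finset.mem_range.mp hr; omega))
      (dependsOn_one _) (by simp)
      ((A.interfaceRVs_subset_outCluster s).trans (A.cluster_subset s _))
    rw [Finset.empty_sdiff, sumOut_empty, mul_one] at key
    rw [Option.getD_none, mul_one, key, Finset.prod_range_succ, mul_one, mul_comm]
    congr 1
    ext v
    rw [Finset.range_add_one, span_insert, Finset.union_empty,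
      Finset.union_comm, Finset.mem_sdiff, Finset.mem_sdiff]
    refine and_congr_right fun hv => not_congr ⟨fun h => A.cluster_subset _ _
      (A.interfaceRVs_subset_inCluster s h), fun h => ?_⟩
    obtain ⟨r, hr, hvr⟩ : ∃ r ≤ s, v ∈ (A.tree r).groundRVs := by
      rcases Finset.mem_union.mp hv with hv | hv
      · exact ⟨s, le_rfl, hv⟩
      · obtain ⟨r, hr, hv⟩ := Finset.mem_biUnion.mp hv
        exact ⟨r, (Finset.mem_range.mp hr).le, hv⟩
    obtain ⟨h1, h2⟩ := A.mem_interfaceRVs_of_mem_tree (Nat.lt_succ_of_le hr) hvr h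
    obtain rfl : s = r := by omega
    exact h2

/-! ### The backward pass -/

theorem messages_eq
    (hβ : DependsOn (β.getD 1) ((A.tree s).cluster (A.tree s).outCluster).groundRVs)
    (hmode : A.mode s ≠ Instantiation.reinstantiateInbound ∨ β = none)
    {i j : Fin (A.tree s).size} (hij : (A.tree s).graph.Adj i j) :
    A.messages E s β i j = (A.tree s).exactMessage (A.content E s (A.alphaIn E s) β) i j := by
  have hJ := A.isJunctionTree s
  have hc := A.dependsOn_content (E := E) (α := A.alphaIn E s) (A.dependsOn_alphaIn s) hβ
  have hc0 := A.dependsOn_content (E := E) (α := A.alphaIn E s) (A.dependsOn_alphaIn s)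
    dependsOn_getD_none
  cases β with
  | none => exact hJ.passMessages_eq hc hij
  | some β =>
    unfold messages
    rcases hm : A.mode s with _ | _ | _
    · exact hJ.outboundPass_eq_of_change hc
        (fun l hl => A.content_eq_of_ne_outCluster hl _)
        (fun i j hij => hJ.passMessages_eq hc0 hij) hij
    · exact hJ.passMessages_eq hc hij
    · simp [hm] at hmode

/-- The messages that `β` is computed from are correct in every mode; an inbound pass to the
in-cluster is all they need. -/
theorem messages_inCluster_eq
    (hβ : DependsOn (β.getD 1) ((A.tree s).cluster (A.tree s).outCluster).groundRVs)
    {k : Fin (A.tree s).size} (hk : (A.tree s).graph.Adj k (A.tree s).inCluster) :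
    A.messages E s β k (A.tree s).inCluster =
      (A.tree s).exactMessage (A.content E s (A.alphaIn E s) β) k (A.tree s).inCluster := by
  by_cases hmode : A.mode s ≠ Instantiation.reinstantiateInbound ∨ β = none
  · exact A.messages_eq hβ hmode hk
  · rw [not_or, not_not] at hmode
    obtain ⟨β, rfl⟩ := Option.ne_none_iff_exists'.mp hmode.2
    have hc := A.dependsOn_content (E := E) (α := A.alphaIn E s) (A.dependsOn_alphaIn s) hβ
    unfold messages
    rw [hmode.1]
    refine (A.isJunctionTree s).inboundExact_inboundPass hc _ _ _ _ hk ?_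
    rw [(A.tree s).graph.dist_self, SimpleGraph.dist_eq_one_iff_adj.mpr hk.symm]

theorem backwardStep_eq (hE : E.obs (s + 1) ⊆ (A.tree (s + 1)).groundRVs)
    (hβ : DependsOn (β.getD 1)
      ((A.tree (s + 1)).cluster (A.tree (s + 1)).outCluster).groundRVs) :
    A.backwardStep E (s + 1) β =
      sumOut ((A.tree (s + 1)).groundRVs \ D.interfaceRVs s)
        (stepWeight D E (s + 1) * β.getD 1) := by
  have hc := A.dependsOn_content (E := E) (α := none) dependsOn_getD_none hβ
  unfold backwardStep
  -- The incoming messages were computed in the presence of `α`, which they do not involve.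
  rw [(A.isJunctionTree _).belief_eq hc
      (fun l hl => A.content_eq_of_ne_inCluster hl _)
      (fun k hk => A.messages_inCluster_eq hβ hk),
    Nat.add_sub_cancel,
    sumOut_sdiff_sumOut_sdiff (A.interfaceRVs_subset_inCluster s) (A.cluster_subset _ _),
    A.prod_content hE, Option.getD_none, one_mul]

/-- The interface `I_s` separates step `s` from the later ones. -/
theorem span_sdiff_tree {T : Finset ℕ} (hT : ∀ r ∈ T, s + 1 ≤ r) :
    A.span T \ (A.tree s).groundRVs = A.span T \ D.interfaceRVs s := by
  ext v
  rw [Finset.mem_sdiff, Finset.mem_sdiff]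
  refine and_congr_right fun hv => not_congr ⟨fun h => ?_, fun h =>
    A.cluster_subset s _ (A.interfaceRVs_subset_outCluster s h)⟩
  obtain ⟨r, hr, hvr⟩ := Finset.mem_biUnion.mp hv
  exact (A.mem_interfaceRVs_of_mem_tree (hT r hr) h hvr).2

theorem exactBeta_succ :
    A.exactBeta E t (s + 1) =
      sumOut (A.span (Finset.Icc (s + 1) t) \ (A.tree s).groundRVs)
        (∏ r ∈ Finset.Icc (s + 1) t, stepWeight D E r) := by
  rw [A.span_sdiff_tree fun r hr => (Finset.mem_Icc.mp hr).1]
  rfl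

/-- Downward induction on the time step: the `β` of the next step, summed over what lies beyond the
out-cluster, extends the sum over one tree to the sum over all later ones. -/
theorem beta_eq_exactBeta (hE : ∀ r ≤ t, E.obs r ⊆ (A.tree r).groundRVs) {s : ℕ} (hst : s < t) :
    A.beta E t (s + 1) = A.exactBeta E t (s + 1) ∧
      DependsOn (A.beta E t (s + 1)) (D.interfaceRVs s) := by
  have hdep : ∀ s, DependsOn (∏ r ∈ Finset.Icc s t, stepWeight D E r)
      (A.span (Finset.Icc s t)) := fun s =>
    A.dependsOn_prod_stepWeight fun r hr => hE r (Finset.mem_Icc.mp hr).2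
  induction hd : t - (s + 1) generalizing s with
  | zero =>
    obtain rfl : t = s + 1 := by omega
    have heq : A.beta E (s + 1) (s + 1) = A.exactBeta E (s + 1) (s + 1) := by
      rw [beta, if_neg (lt_irrefl _), A.backwardStep_eq (hE _ le_rfl) dependsOn_getD_none]
      simp [exactBeta, stepWeight]
    exact ⟨heq, heq ▸ dependsOn_sumOut_sdiff (hdep (s + 1))⟩
  | succ n ih =>
    have hs1 : s + 1 < t := by omega
    obtain ⟨ih1, ih2⟩ := ih hs1 (by omega)
    have heq : A.beta E t (s + 1) = A.exactBeta E t (s + 1) := by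
      rw [beta, if_pos hs1, A.backwardStep_eq (β := some (A.beta E t (s + 1 + 1))) (hE _ hs1.le)
        (ih2.mono (A.interfaceRVs_subset_outCluster (s + 1))), Option.getD_some, ih1,
        A.exactBeta_succ]
      have key := sumOut_mul_sumOut_mul_sumOut (X := ∅) (f := 1)
        (A.dependsOn_stepWeight (hE (s + 1) hs1.le)) (dependsOn_one _) (hdep (s + 1 + 1))
        (by simp) ((A.interfaceRVs_subset_inCluster s).trans (A.cluster_subset (s + 1) _))
      rw [Finset.empty_sdiff, sumOut_empty, one_mul, one_mul, Finset.empty_union] at key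
      have hIcc : Finset.Icc (s + 1) t = insert (s + 1) (Finset.Icc (s + 1 + 1) t) :=
        (Finset.insert_Icc_add_one_left_eq_Icc hs1.le).symm
      rw [key, exactBeta, Nat.add_sub_cancel, hIcc, Finset.prod_insert (by simp), ← span_insert]
      rfl
    exact ⟨heq, heq ▸ dependsOn_sumOut_sdiff (hdep (s + 1))⟩

theorem dependsOn_betaIn (hE : ∀ r ≤ t, E.obs r ⊆ (A.tree r).groundRVs) (s : ℕ) :
    DependsOn ((A.betaIn E t s).getD 1)
      ((A.tree s).cluster (A.tree s).outCluster).groundRVs := by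
  unfold betaIn
  split_ifs with h
  · exact (A.beta_eq_exactBeta hE h).2.mono (A.interfaceRVs_subset_outCluster s)
  · exact dependsOn_getD_none

end LDJT

/-! ### Queries -/

section Query

variable {V : Vocabulary} {τ : Type}

/-- A conditional probability is a quotient of unnormalised marginals; the partition function
cancels. -/
theorem PM.query_eq (G : PM V τ) {v : GroundRV V τ} (hv : v ∈ PM.groundRVs G)
    (a : V.range v.symbol) (S : Set (Assignment V τ)) (hS : PM.prob G S ≠ 0) :
    PM.query G v a S =
      sumOut (PM.groundRVs G \ {v}) (S.indicator (PM.weight G))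
          (Function.update (someAssignment V τ) v a) /
        ∑ b, sumOut (PM.groundRVs G \ {v}) (S.indicator (PM.weight G))
          (Function.update (someAssignment V τ) v b) := by
  classical
  set q : V.range v.symbol → ℝ≥0 := fun b => sumOut (PM.groundRVs G \ {v})
    (S.indicator (PM.weight G)) (Function.update (someAssignment V τ) v b) with hq
  -- The probability of an event, with the sum over the values of `v` made explicit.
  have hprob : ∀ T : Set (Assignment V τ), PM.prob G T =
      ∑ b, sumOut (PM.groundRVs G \ {v}) (T.indicator (PM.joint G))
        (Function.update (someAssignment V τ) v b) := fun T => by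
    rw [← sumOut_singleton v, sumOut_union Finset.disjoint_sdiff,
      Finset.union_sdiff_of_subset (Finset.singleton_subset_iff.mpr hv)]
    rfl
  have hjoint : ∀ x, S.indicator (PM.joint G) x =
      (PM.partition G)⁻¹ * S.indicator (PM.weight G) x := fun x => by
    by_cases hx : x ∈ S <;> simp [hx, PM.joint, div_eq_inv_mul]
  have hall : PM.prob G S = (PM.partition G)⁻¹ * ∑ b, q b := by
    rw [hprob, Finset.mul_sum]
    refine Finset.sum_congr rfl fun b _ => ?_
    rw [hq, ← sumOut_const_mul]
    exact congrFun (congrArg _ (funext hjoint)) _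
  have hone : PM.prob G ({x | x v = a} ∩ S) = (PM.partition G)⁻¹ * q a := by
    rw [hprob, Finset.sum_eq_single a]
    · rw [hq, ← sumOut_const_mul]
      refine sumOut_apply_congr fun y hy => ?_
      have : y v = a := by rw [hy v (by simp), Function.update_self]
      rw [← hjoint]
      by_cases hx : y ∈ S <;> simp [hx, this]
    · intro b _ hb
      rw [sumOut_apply_congr (g := fun _ => 0 * 0), sumOut_const_mul, zero_mul]
      intro y hy
      have : y v = b := by rw [hy v (by simp), Function.update_self]
      simp [this, hb]
    · simp
  have hZ : (PM.partition G)⁻¹ ≠ 0 := fun h => hS (by rw [hall, h, zero_mul])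
  rw [PM.query, hall, hone, mul_div_mul_left _ _ hZ]

end Query

namespace LDJT

variable {V : Vocabulary} {D : PDM V} (A : LDJT D) {E : Evidence V} {t : ℕ} {s : ℕ}

theorem prod_stepWeight_eq_indicator :
    ∏ r ∈ Finset.range (t + 1), stepWeight D E r =
      (E.upTo t).indicator (PM.weight (D.unrolled t)) := by
  classical
  funext x
  have hagree : ∏ r ∈ Finset.range (t + 1), agree (E.obs r) E.val x =
      if x ∈ E.upTo t then 1 else 0 := by
    unfold agree
    split_ifs with hx
    · exact Finset.prod_eq_one fun r hr =>
        if_pos (hx r (Nat.lt_succ_iff.mp (Finset.mem_range.mp hr)))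
    · simp only [Evidence.upTo, Set.mem_ofPred_eq, not_forall] at hx
      obtain ⟨r, hr, hx⟩ := hx
      exact Finset.prod_eq_zero (Finset.mem_range.mpr (Nat.lt_succ_of_le hr))
        (if_neg fun h => hx.elim fun v hv => hv.elim fun hv hne => hne (h v hv))
  simp only [stepWeight, Finset.prod_mul_distrib]
  rw [PDM.unrolled, PM.weight_sum, Pi.mul_apply, Finset.prod_apply x _ fun r => agree _ _, hagree]
  by_cases hx : x ∈ E.upTo t <;> simp [hx]

/-- The unnormalised marginal that a query to the tree of step `s` computes is that of the whole
unrolled model with its evidence, extended to all random variables of the trees. -/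
theorem sumOut_belief_eq (hE : ∀ r ≤ t, E.obs r ⊆ (A.tree r).groundRVs) (hst : s < t)
    (hmode : A.mode s ≠ Instantiation.reinstantiateInbound) {k : Fin (A.tree s).size}
    {v : GroundRV V ℕ} (hv : v ∈ ((A.tree s).cluster k).groundRVs) :
    sumOut (((A.tree s).cluster k).groundRVs \ {v})
        ((A.tree s).belief (A.content E s (A.alphaIn E s) (A.betaIn E t s))
          (A.messages E s (A.betaIn E t s)) k) =
      sumOut (A.span (Finset.range (t + 1)) \ {v})
        (∏ r ∈ Finset.range (t + 1), stepWeight D E r) := by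
  have hβ := A.dependsOn_betaIn hE s
  have hc := A.dependsOn_content (E := E) (α := A.alphaIn E s) (A.dependsOn_alphaIn s) hβ
  have hβeq : (A.betaIn E t s).getD 1 =
      sumOut (A.span (Finset.Icc (s + 1) t) \ (A.tree s).groundRVs)
        (∏ r ∈ Finset.Icc (s + 1) t, stepWeight D E r) := by
    rw [betaIn, if_pos hst, Option.getD_some, (A.beta_eq_exactBeta hE hst).1, A.exactBeta_succ]
  have hsplit : Finset.range (t + 1) = Finset.range s ∪ insert s (Finset.Icc (s + 1) t) := by
    ext r
    simp only [Finset.mem_range, Finset.mem_union, Finset.mem_insert, Finset.mem_Icc]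
    omega
  have hdisj : Disjoint (Finset.range s) (insert s (Finset.Icc (s + 1) t)) := by
    rw [Finset.disjoint_left]
    intro r
    simp only [Finset.mem_range, Finset.mem_insert, Finset.mem_Icc]
    omega
  have hspan : A.span (Finset.range (t + 1)) =
      A.span (Finset.range s) ∪ (A.tree s).groundRVs ∪ A.span (Finset.Icc (s + 1) t) := by
    rw [hsplit, Finset.union_assoc, ← span_insert]
    exact Finset.union_biUnion
  rw [(A.isJunctionTree s).belief_eq hc (fun _ _ => rfl)
      (fun i hi => A.messages_eq hβ (Or.inl hmode) hi),
    sumOut_sdiff_sumOut_sdiff (Finset.singleton_subset_iff.mpr hv) (A.cluster_subset s k),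
    A.prod_content (hE s hst.le), hβeq, A.alphaIn_eq fun r hr => hE r (by omega),
    sumOut_mul_sumOut_mul_sumOut (A.dependsOn_stepWeight (hE s hst.le))
      (A.dependsOn_prod_stepWeight fun r hr => hE r (by have := Finset.mem_range.mp hr; omega))
      (A.dependsOn_prod_stepWeight fun r hr => hE r (Finset.mem_Icc.mp hr).2) ?_
      (Finset.singleton_subset_iff.mpr (A.cluster_subset s k hv)), ← hspan, hsplit,
    Finset.prod_union hdisj, Finset.prod_insert (by simp)]
  · congr 1
    ring
  · intro u hu hu'
    obtain ⟨r, hr, hu⟩ := Finset.mem_biUnion.mp hu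
    obtain ⟨q, hq, hu'⟩ := Finset.mem_biUnion.mp hu'
    have hr := Finset.mem_range.mp hr
    have hq := (Finset.mem_Icc.mp hq).1
    have := (A.mem_interfaceRVs_of_mem_tree (by omega) hu hu').1
    omega

/-- A query to the tree of an earlier time step is answered correctly: random variables of the trees
that do not occur in the unrolled model contribute a constant, which the normalisation removes. -/
theorem answer_eq_query
    (hobs : ∀ r ≤ t, E.obs r ⊆ PM.groundRVs (D.unrolled t))
    (hE : ∀ r ≤ t, E.obs r ⊆ (A.tree r).groundRVs) (hst : s < t)
    (hmode : A.mode s ≠ Instantiation.reinstantiateInbound) {v : GroundRV V ℕ}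
    (hvG : v ∈ PM.groundRVs (D.unrolled t)) (hprob : PM.prob (D.unrolled t) (E.upTo t) ≠ 0)
    {k : Fin (A.tree s).size} (hv : v ∈ ((A.tree s).cluster k).groundRVs) (a : V.range v.symbol) :
    A.answer E t s k v a = PM.query (D.unrolled t) v a (E.upTo t) := by
  set F := (E.upTo t).indicator (PM.weight (D.unrolled t)) with hF
  have hFdep : DependsOn F (PM.groundRVs (D.unrolled t)) := by
    rw [hF, ← prod_stepWeight_eq_indicator]
    refine dependsOn_prod fun r hr => dependsOn_mul ((PM.dependsOn_weight _).mono fun u hu => ?_)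
      ((dependsOn_agree _ _).mono (hobs r (Nat.lt_succ_iff.mp (Finset.mem_range.mp hr))))
    exact PM.mem_groundRVs_sum.mpr ⟨r, hr, hu⟩
  have hsub : PM.groundRVs (D.unrolled t) ⊆ A.span (Finset.range (t + 1)) := fun u hu => by
    obtain ⟨r, hr, hu⟩ := PM.mem_groundRVs_sum.mp hu
    exact Finset.mem_biUnion.mpr ⟨r, hr, A.groundRVs_modelAt_subset r hu⟩
  have hscale : ∀ x, sumOut (A.span (Finset.range (t + 1)) \ {v}) F x =
      (Fintype.card (∀ u : (A.span (Finset.range (t + 1)) \ PM.groundRVs (D.unrolled t) :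
        Finset (GroundRV V ℕ)), V.range u.1.symbol) : ℝ≥0) *
        sumOut (PM.groundRVs (D.unrolled t) \ {v}) F x := fun x => by
    rw [← sumOut_sdiff_sumOut_sdiff (Finset.singleton_subset_iff.mpr hvG) hsub,
      sumOut_eq_smul hFdep (fun u hu hu' => (Finset.mem_sdiff.mp hu').2 hu), sumOut_const_mul]
  have hcard : (Fintype.card (∀ u : (A.span (Finset.range (t + 1)) \
      PM.groundRVs (D.unrolled t) : Finset (GroundRV V ℕ)), V.range u.1.symbol) : ℝ≥0) ≠ 0 :=
    Nat.cast_ne_zero.mpr Fintype.card_ne_zero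
  rw [PM.query_eq _ hvG a _ hprob, answer, ParclusterGraph.answer]
  simp only [A.sumOut_belief_eq hE hst hmode hv, prod_stepWeight_eq_indicator, ← hF, hscale]
  rw [← Finset.mul_sum, mul_div_mul_left _ _ hcard]

end LDJT

end LiftedDynamic

theorem mainTheorem1 {V : LiftedDynamic.Vocabulary} (D : LiftedDynamic.PDM V)
    (A : LiftedDynamic.LDJT D) (E : LiftedDynamic.Evidence V) (t : ℕ)
    (hE : ∀ s ≤ t, ∀ v ∈ E.obs s,
      v.time = s ∧ v ∈ LiftedDynamic.PM.groundRVs (D.unrolled t)) :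
    (∀ s, 1 ≤ s → s ≤ t → A.beta E t s = A.exactBeta E t s) ∧
    (∀ π, π < t → A.mode π ≠ LiftedDynamic.Instantiation.reinstantiateInbound →
      ∀ v ∈ LiftedDynamic.PM.groundRVs (D.unrolled t), v.time = π →
        (∃ k, v ∈ ((A.tree π).cluster k).groundRVs) ∧
        (LiftedDynamic.PM.prob (D.unrolled t) (E.upTo t) ≠ 0 →
          ∀ k, v ∈ ((A.tree π).cluster k).groundRVs → ∀ a : V.range v.symbol,
            A.answer E t π k v a =
              LiftedDynamic.PM.query (D.unrolled t) v a (E.upTo t))) := by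
  have hobs : ∀ r ≤ t, E.obs r ⊆ (A.tree r).groundRVs := fun r hr v hv => by
    have := A.mem_tree_of_mem_unrolled (hE r hr v hv).2
    rwa [(hE r hr v hv).1] at this
  refine ⟨fun s h1 hst => ?_, fun π hπ hmode v hv hvt => ⟨?_, fun hprob k hk a => ?_⟩⟩
  · obtain ⟨s, rfl⟩ : ∃ q, s = q + 1 := ⟨s - 1, by omega⟩
    exact (A.beta_eq_exactBeta hobs hst).1
  · have h := A.mem_tree_of_mem_unrolled hv
    rw [hvt] at h
    obtain ⟨k, -, hk⟩ := Finset.mem_biUnion.mp h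
    exact ⟨k, hk⟩
  · exact A.answer_eq_query (fun r hr v hv => (hE r hr v hv).2) hobs hπ hmode hv hprob hk a
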